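/- **Model.** In *secretary matching with $k$ arrivals* there is a bipartite graph $(N\cup V,E)$ with $n=|N|$ candidates, a set $V$ of offline nodes, and nonnegative edge weights $w$. Every candidate arrives exactly $k$ times, and all $kn$ arrivals are presented in uniformly random order, one per round. The algorithm knows $n$, $k$ and $V$ in advance. When a candidate arrives, the algorithm may irrevocably accept one edge between this candidate and an offline node, provided that both endpoints are still unmatched. The value of a run is the total weight $w(M)$ of the matching $M$ of accepted edges. Let $w(M^*)$ be the maximum weight of a matching in the whole graph. An *$\alpha$-approximation algorithm* $\mathcal A$ for offline matching ($0\le\alpha\le 1$) returns, for every $N'\subseteq N$, a matching $\mathcal A(N')$ between $N'$ and $V$ of weight at least $\alpha$ times the maximum weight of a matching between $N'$ and $V$. A randomized online algorithm *combined with* $\mathcal A$ learns about edges and weights only by calling $\mathcal A$, at most once per round and only on sets of candidates that have already arrived; its decisions are based on the arrivals so far, the answers of $\mathcal A$ so far, the edges accepted so far and its own random bits, which are independent of the order of arrival. We say that *ratio $c\cdot\alpha-o(1)$ is achieved for $k$ arrivals* if there are such online algorithms (one for each $n$ and $V$, not depending on $\alpha$, $\mathcal A$, $E$, $w$) and a sequence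 $\varepsilon(n)\to 0$ such that for all $n$, all finite $V$, all $\alpha\in[0,1]$, all $E$ and $w$, and every $\alpha$-approximation algorithm $\mathcal A$, $$\mathbb E[w(M)]\ \ge\ (c\cdot\alpha-\varepsilon(n))\cdot w(M^*).$$ **Theorem.** For secretary matching with $2$ arrivals, ratio $0.5721\cdot\alpha-o(1)$ is achieved. For every $k\ge 2$, for secretary matching with $k$ arrivals, ratio $$\alpha\cdot\left(1-\frac1{2^{k-1}}+\frac1{2^{2k}}-\frac1{2^{2k}(2^k-1)^2}\right)-o(1)$$ is achieved. -/

import Mathlib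

open scoped NNReal

noncomputable section

namespace SecretaryMatching

/-- An additive bipartite matching instance: candidates `Fin n`, offline nodes `Fin m`, an edge set
and a nonnegative weight per edge (weights of non-edges are never used). -/
structure Instance (n m : ℕ) where
  E : Finset (Fin n × Fin m)
  w : Fin n × Fin m → ℝ≥0

/-- The weight of a set of edges. -/
def Instance.weight {n m : ℕ} (I : Instance n m) (M : Finset (Fin n × Fin m)) : ℝ≥0 :=
  ∑ e ∈ M, I.w e

/-- `M` is a matching of the subgraph induced by the candidates in `S` and all offline nodes. -/
def Instance.IsMatchingOn {n m : ℕ} (I : Instance n m) (S : Finset (Fin n))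
    (M : Finset (Fin n × Fin m)) : Prop :=
  M ⊆ I.E ∧ (∀ e ∈ M, e.1 ∈ S) ∧ ∀ e ∈ M, ∀ f ∈ M, e.1 = f.1 ∨ e.2 = f.2 → e = f

open Classical in
/-- The maximum weight of a matching between the candidates in `S` and the offline nodes. -/
def Instance.opt {n m : ℕ} (I : Instance n m) (S : Finset (Fin n)) : ℝ≥0 :=
  (Finset.univ.filter (I.IsMatchingOn S)).sup I.weight

/-- `A` is (the run on `I` of) an `α`-approximation algorithm for offline matching: on every set of
candidates it returns a matching of at least `α` times the maximum weight. -/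
def Instance.IsApprox {n m : ℕ} (I : Instance n m) (α : ℝ)
    (A : Finset (Fin n) → Finset (Fin n × Fin m)) : Prop :=
  ∀ S, I.IsMatchingOn S (A S) ∧ α * I.opt S ≤ I.weight (A S)

/-- A deterministic online algorithm with oracle access to an offline matching algorithm.
In every round it sees the list of all arrivals so far (the last one is the current one), the
list of all previous oracle answers, and the set of accepted edges. It may call the oracle
once, on a set of candidates, and then (now knowing the answer) it either does nothing or proposes
an offline node to which the current candidate is to be matched.
Edges and weights are accessed only through the oracle. -/
structure Policy (n m : ℕ) where
  query : List (Fin n) → List (Finset (Fin n × Fin m)) → Finset (Fin n × Fin m) → Finset (Fin n)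
  decide : List (Fin n) → List (Finset (Fin n × Fin m)) → Finset (Fin n × Fin m) →
    Option (Fin m)

/-- What has happened so far: arrivals, oracle answers (both in order of time), accepted edges. -/
structure State (n m : ℕ) where
  arrivals : List (Fin n)
  answers : List (Finset (Fin n × Fin m))
  accepted : Finset (Fin n × Fin m)

/-- One round, in which candidate `c` arrives. The oracle can be called only on candidates that have
arrived. A proposed edge is accepted, irrevocably, if it is an edge of the graph and both its
endpoints are still unmatched; otherwise nothing is accepted. -/
def Policy.step {n m : ℕ} (P : Policy n m) (I : Instance n m)
    (A : Finset (Fin n) → Finset (Fin n × Fin m)) (s : State n m) (c : Fin n) : State n m :=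
  let arrivals := s.arrivals ++ [c]
  let answers := s.answers ++ [A (P.query arrivals s.answers s.accepted ∩ arrivals.toFinset)]
  { arrivals := arrivals
    answers := answers
    accepted :=
      match P.decide arrivals answers s.accepted with
      | none => s.accepted
      | some v =>
        if (c, v) ∈ I.E ∧ ∀ e ∈ s.accepted, e.1 ≠ c ∧ e.2 ≠ v then insert (c, v) s.accepted
        else s.accepted }

/-- An order of the `n * k` arrivals, in which every candidate arrives exactly `k` times:
`(σ t).1` is the candidate that arrives in round `t`. -/
abbrev ArrivalOrder (k n : ℕ) : Type := Fin (n * k) ≃ Fin n × Fin k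

/-- The set of accepted edges at the end of the `n * k` rounds. -/
def Policy.run {n m : ℕ} (P : Policy n m) (I : Instance n m)
    (A : Finset (Fin n) → Finset (Fin n × Fin m)) {k : ℕ} (σ : ArrivalOrder k n) :
    Finset (Fin n × Fin m) :=
  ((List.ofFn fun t => (σ t).1).foldl (P.step I A) ⟨[], [], ∅⟩).accepted

/-- A randomized online algorithm: it draws a seed, independently of the order of arrival,
and then runs the deterministic algorithm belonging to this seed. -/
structure RandomizedAlgorithm (n m : ℕ) where
  seeds : ℕ
  dist : PMF (Fin seeds)
  policy : Fin seeds → Policy n m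

/-- The expected weight of the accepted matching over the random seed and a uniformly random order
of the `n * k` arrivals. -/
def RandomizedAlgorithm.expectedWeight {n m : ℕ} (R : RandomizedAlgorithm n m) (k : ℕ)
    (I : Instance n m) (A : Finset (Fin n) → Finset (Fin n × Fin m)) : ℝ :=
  ∑ s : Fin R.seeds, (R.dist s).toReal *
    ((∑ σ : ArrivalOrder k n, (I.weight ((R.policy s).run I A σ) : ℝ)) /
      Fintype.card (ArrivalOrder k n))

/-- For secretary matching with `k` arrivals there is an online algorithm that, combined with any
`α`-approximation algorithm for offline matching, has approximation ratio `c * α - o(1)`.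
The algorithm knows `n` and the offline nodes in advance (and `k`), but not `α`. The asymptotics are
in `n`, uniformly in everything else. -/
def AchievesRatio (k : ℕ) (c : ℝ) : Prop :=
  ∃ (R : ∀ n m : ℕ, RandomizedAlgorithm n m) (ε : ℕ → ℝ),
    Filter.Tendsto ε Filter.atTop (nhds 0) ∧
    ∀ (n m : ℕ) (α : ℝ), 0 ≤ α → α ≤ 1 →
    ∀ (I : Instance n m) (A : Finset (Fin n) → Finset (Fin n × Fin m)), I.IsApprox α A →
      (c * α - ε n) * I.opt Finset.univ ≤ (R n m).expectedWeight k I A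

end SecretaryMatching

end

/-!
The algorithm observes a sample of the arrivals, each belonging to the sample independently with
probability `p` (the sample is an initial segment of binomial length), and then looks at the oracle's
matching of the set `W` of candidates seen so far. The edges of this matching at candidates that have
arrivals left are *reserved*: their candidates are certain to return, and are then matched. Offline
nodes whose partner is *exhausted*, that is, has all its `k` arrivals in the sample, are left over.
They are given to candidates that first arrive after the sample: such a candidate `c` is matched along
its edge in the oracle's matching of all candidates seen so far, if the offline node of that edge is
neither reserved nor matched.

For the analysis, fix the pattern of arrivals and average over all relabellings of the candidates,
which leave the uniform distribution of the order invariant. By exchangeability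
(`card_mul_sum_perm`), with `L = |W|` and `K` exhausted candidates,

* the reserved edges have expected weight at least `α * OPT * (L - K) / n`;
* an offline node is not reserved with probability at least `K / L`, and the newcomer that raises the
  number of candidates seen from `s` to `s + 1` blocks it with probability at most `1 / (s + 1)`, so
  that it is free with probability at least `K / s` once `s` candidates have been seen
  (`card_exhausted_mul_le`);
* hence the next newcomer gains at least `(K / s) * α * OPT / n`, and all newcomers together gain at
  least `K * (log n - log L) * α * OPT / n` (`mul_log_le_sum_valueAt_new`).

It remains to average `(L - K) + K * (log n - log L)` over the sample. With `q = 1 - p`, the mean of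
`L / n` is `x = 1 - q ^ k`, and replacing the logarithm by its tangent at `x` leaves only moments of
`K`, `L` and `K * L`, which are computed exactly. The result is the ratio
`1 - p ^ k - q ^ k - p ^ k * log (1 - q ^ k)` up to an error `O(1 / n)` (`achievesRatio_of_le`).
For `k = 2` take `p = 0.491`; for general `k` take `p = 1 / 2` and bound the logarithm linearly.
-/

open scoped NNReal

namespace SecretaryMatching

/-! ### Exchangeability under a random relabelling of the candidates -/

section Exchangeability

variable {ι : Type*} [DecidableEq ι]

/-- `G` does not change when the relabelling `g` is precomposed with a transposition of two elements
of `X`: it depends on `g` only through the image of `X` and the values of `g` off `X`. -/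
def SwapInvariant {β : Type*} (X : Finset ι) (G : Equiv.Perm ι → β) : Prop :=
  ∀ g, ∀ a ∈ X, ∀ b ∈ X, G (g * Equiv.swap a b) = G g

lemma SwapInvariant.mono {β : Type*} {X Y : Finset ι} {G : Equiv.Perm ι → β}
    (h : SwapInvariant Y G) (hXY : X ⊆ Y) : SwapInvariant X G :=
  fun g a ha b hb => h g a (hXY ha) b (hXY hb)

lemma swapInvariant_image (X : Finset ι) :
    SwapInvariant X (fun g : Equiv.Perm ι => X.image g) := by
  intro g a ha b hb
  have hsub : X.image (g * Equiv.swap a b) ⊆ X.image g := by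
    intro y hy
    obtain ⟨x, hx, rfl⟩ := Finset.mem_image.1 hy
    refine Finset.mem_image.2 ⟨Equiv.swap a b x, ?_, rfl⟩
    rw [Equiv.swap_apply_def]
    split_ifs <;> assumption
  refine Finset.eq_of_subset_of_card_le hsub ?_
  rw [Finset.card_image_of_injective _ g.injective,
    Finset.card_image_of_injective _ (g * Equiv.swap a b).injective]

/-- Conditionally on the image of `X`, the label of each element of `X` is uniform on that image. -/
lemma card_mul_sum_perm [Fintype ι] {X Z : Finset ι} (hZ : Z ⊆ X) (Φ : Equiv.Perm ι → ι → ℝ)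
    (hΦ : SwapInvariant X Φ) :
    (X.card : ℝ) * ∑ g : Equiv.Perm ι, ∑ z ∈ Z, Φ g (g z) =
      Z.card * ∑ g : Equiv.Perm ι, ∑ y ∈ X.image g, Φ g y := by
  have hconst : ∀ z ∈ X, ∀ z' ∈ X,
      ∑ g : Equiv.Perm ι, Φ g (g z) = ∑ g : Equiv.Perm ι, Φ g (g z') := by
    intro z hz z' hz'
    rw [← Equiv.sum_comp (Equiv.mulRight (Equiv.swap z z')) (fun g => Φ g (g z))]
    refine Finset.sum_congr rfl fun g _ => ?_
    simp only [Equiv.coe_mulRight]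
    rw [hΦ g z hz z' hz', Equiv.Perm.mul_apply, Equiv.swap_apply_left]
  have himage : ∀ g : Equiv.Perm ι, ∑ y ∈ X.image g, Φ g y = ∑ z ∈ X, Φ g (g z) :=
    fun g => Finset.sum_image fun a _ b _ h => g.injective h
  simp only [himage]
  rw [Finset.sum_comm, Finset.sum_comm (t := X), Finset.mul_sum, Finset.mul_sum]
  rcases Z.eq_empty_or_nonempty with rfl | ⟨z₀, hz₀⟩
  · simp
  rw [Finset.sum_congr rfl fun z hz => by rw [hconst z (hZ hz) z₀ (hZ hz₀)],
    Finset.sum_congr (s₁ := X) rfl fun z hz => by rw [hconst z hz z₀ (hZ hz₀)]]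
  simp only [Finset.sum_const, nsmul_eq_mul]
  ring

end Exchangeability

/-! ### Matchings -/

section Matchings

variable {n m : ℕ} (I : Instance n m)

/-- The total weight of the edges of `M` at the candidate `c`. -/
def Instance.valueAt (M : Finset (Fin n × Fin m)) (c : Fin n) : ℝ :=
  ∑ v, if (c, v) ∈ M then (I.w (c, v) : ℝ) else 0

lemma Instance.valueAt_nonneg (M : Finset (Fin n × Fin m)) (c : Fin n) : 0 ≤ I.valueAt M c :=
  Finset.sum_nonneg fun v _ => by split_ifs <;> positivity

lemma Instance.weight_eq_sum_valueAt {S : Finset (Fin n)} {M : Finset (Fin n × Fin m)}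
    (hM : ∀ e ∈ M, e.1 ∈ S) : (I.weight M : ℝ) = ∑ c ∈ S, I.valueAt M c := by
  classical
  unfold Instance.weight Instance.valueAt
  push_cast
  rw [← Finset.sum_product', ← Finset.sum_filter]
  refine Finset.sum_congr ?_ fun _ _ => rfl
  ext e
  simp only [Finset.mem_filter, Finset.mem_product, Finset.mem_univ, and_true]
  exact ⟨fun h => ⟨hM e h, h⟩, fun h => h.2⟩

lemma Instance.weight_le_opt {S : Finset (Fin n)} {M : Finset (Fin n × Fin m)}
    (hM : I.IsMatchingOn S M) : I.weight M ≤ I.opt S := by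
  classical
  exact Finset.le_sup (f := I.weight) (by simpa using hM)

lemma Instance.exists_isMatchingOn_weight_eq_opt (S : Finset (Fin n)) :
    ∃ M, I.IsMatchingOn S M ∧ I.weight M = I.opt S := by
  classical
  have hne : (Finset.univ.filter (I.IsMatchingOn S)).Nonempty :=
    ⟨∅, by simp [Instance.IsMatchingOn]⟩
  obtain ⟨M, hM, hw⟩ := Finset.exists_mem_eq_sup _ hne I.weight
  exact ⟨M, by simpa using hM, hw.symm⟩

/-- A uniformly random set of `|X|` of the `n` candidates keeps on average a fraction `|X| / n` of
the optimum. -/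
lemma Instance.card_mul_opt_le_sum_opt_image (X : Finset (Fin n)) :
    (X.card : ℝ) * (n.factorial * I.opt Finset.univ) ≤
      n * ∑ g : Equiv.Perm (Fin n), (I.opt (X.image g) : ℝ) := by
  classical
  obtain ⟨M, hM, hw⟩ := I.exists_isMatchingOn_weight_eq_opt Finset.univ
  have h := card_mul_sum_perm (Finset.subset_univ X)
    (fun (_ : Equiv.Perm (Fin n)) c => I.valueAt M c) (fun _ _ _ _ _ => rfl)
  have huniv : ∀ g : Equiv.Perm (Fin n), ∑ c ∈ Finset.univ.image g, I.valueAt M c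
      = I.opt Finset.univ := by
    intro g
    rw [← hw, Finset.image_univ_equiv, ← I.weight_eq_sum_valueAt fun e _ => Finset.mem_univ _]
  simp only [huniv, Finset.sum_const, Finset.card_univ, Fintype.card_perm, Fintype.card_fin,
    nsmul_eq_mul] at h
  rw [← h]
  refine mul_le_mul_of_nonneg_left (Finset.sum_le_sum fun g _ => ?_) (Nat.cast_nonneg n)
  have hsub : I.IsMatchingOn (X.image g) (M.filter fun e => e.1 ∈ X.image g) := by
    refine ⟨(Finset.filter_subset _ _).trans hM.1, fun e he => (Finset.mem_filter.1 he).2, ?_⟩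
    exact fun e he f hf => hM.2.2 e (Finset.mem_filter.1 he).1 f (Finset.mem_filter.1 hf).1
  refine le_trans (le_of_eq ?_) (NNReal.coe_le_coe.2 (I.weight_le_opt hsub))
  rw [I.weight_eq_sum_valueAt hsub.2.1, Finset.sum_image fun a _ b _ h => g.injective h]
  refine Finset.sum_congr rfl fun z hz => ?_
  have hz' : g z ∈ X.image g := Finset.mem_image_of_mem g hz
  simp only [Instance.valueAt, Finset.mem_filter, hz', and_true]

/-- At most one edge of a matching meets the offline node `v`. -/
lemma Instance.IsMatchingOn.sum_indicator_le_one {I : Instance n m} {S : Finset (Fin n)}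
    {M : Finset (Fin n × Fin m)} (hM : I.IsMatchingOn S M) (v : Fin m) (Y : Finset (Fin n)) :
    ∑ y ∈ Y, (if (y, v) ∈ M then (1 : ℝ) else 0) ≤ 1 := by
  classical
  rw [← Finset.sum_filter, Finset.sum_const, nsmul_eq_mul, mul_one]
  have : (Y.filter fun y => (y, v) ∈ M).card ≤ 1 := by
    refine Finset.card_le_one.2 fun a ha b hb => ?_
    exact congrArg Prod.fst (hM.2.2 _ (Finset.mem_filter.1 ha).2 _ (Finset.mem_filter.1 hb).2
      (Or.inr rfl))
  exact_mod_cast this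

end Matchings

/-! ### The online algorithm -/

section Algorithm

variable {n m : ℕ}

open Classical in
/-- Some offline node of `s`, if there is one. -/
noncomputable def pick (s : Set (Fin m)) : Option (Fin m) :=
  if h : s.Nonempty then some h.choose else none

lemma pick_eq_some_iff {s : Set (Fin m)} (hs : s.Subsingleton) {v : Fin m} :
    pick s = some v ↔ v ∈ s := by
  unfold pick
  split_ifs with h
  · exact ⟨fun hv => Option.some.inj hv ▸ h.choose_spec,
      fun hv => congrArg some (hs h.choose_spec hv)⟩
  · simpa using fun hv => h ⟨v, hv⟩

/-- The edges that the policy sets aside at the end of a sampling phase of `T` rounds: the edges of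
the oracle's matching of the sample whose candidates arrived in the sample but have not yet used up
all their `k` arrivals. The candidate of such an edge is certain to return. For `T = 0` no
candidate qualifies, whatever the first answer is. -/
def reservedEdges (k T : ℕ) (arrivals : List (Fin n))
    (answers : List (Finset (Fin n × Fin m))) : Finset (Fin n × Fin m) :=
  (answers[T - 1]?.getD ∅).filter fun e =>
    e.1 ∈ arrivals.take T ∧ (arrivals.take T).count e.1 < k

open Classical in
/-- The policy with a sampling phase of `T` rounds. In every round it calls the oracle on all
candidates seen so far. After the sampling phase, a candidate of the sample is matched along its
reserved edge, and a candidate that arrives for the first time is matched along its edge in the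
oracle's current answer, unless the offline node of that edge is reserved. -/
noncomputable def samplingPolicy (n m k T : ℕ) : Policy n m where
  query arrivals _ _ := arrivals.toFinset
  decide arrivals answers _ :=
    if arrivals.length ≤ T then none
    else match arrivals.getLast? with
      | none => none
      | some c =>
        if c ∈ arrivals.take T then pick {v | (c, v) ∈ reservedEdges k T arrivals answers}
        else if c ∈ arrivals.dropLast then none
        else pick {v | (c, v) ∈ answers.getLastD ∅ ∧
          ∀ e ∈ reservedEdges k T arrivals answers, e.2 ≠ v}

variable (I : Instance n m) (A : Finset (Fin n) → Finset (Fin n × Fin m)) (k : ℕ)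

/-- The state of the sampling policy after the arrivals `l`. -/
noncomputable def stateAfter (T : ℕ) (l : List (Fin n)) : State n m :=
  l.foldl ((samplingPolicy n m k T).step I A) ⟨[], [], ∅⟩

lemma stateAfter_concat (T : ℕ) (l : List (Fin n)) (c : Fin n) :
    stateAfter I A k T (l ++ [c]) =
      (samplingPolicy n m k T).step I A (stateAfter I A k T l) c := by
  simp [stateAfter]

lemma arrivals_stateAfter (T : ℕ) (l : List (Fin n)) :
    (stateAfter I A k T l).arrivals = l := by
  induction l using List.reverseRecOn with
  | nil => rfl
  | append_singleton l c ih => rw [stateAfter_concat]; simp [Policy.step, ih]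

lemma answers_stateAfter_concat (T : ℕ) (l : List (Fin n)) (c : Fin n) :
    (stateAfter I A k T (l ++ [c])).answers =
      (stateAfter I A k T l).answers ++ [A (l ++ [c]).toFinset] := by
  rw [stateAfter_concat]
  simp [Policy.step, arrivals_stateAfter, samplingPolicy]

lemma length_answers_stateAfter (T : ℕ) (l : List (Fin n)) :
    (stateAfter I A k T l).answers.length = l.length := by
  induction l using List.reverseRecOn with
  | nil => rfl
  | append_singleton l c ih => rw [answers_stateAfter_concat]; simp [ih]

lemma answers_stateAfter_append_getElem? (T : ℕ) (p r : List (Fin n)) (hp : p ≠ []) :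
    (stateAfter I A k T (p ++ r)).answers[p.length - 1]? = some (A p.toFinset) := by
  induction r using List.reverseRecOn with
  | nil =>
    obtain ⟨p, c, rfl⟩ : ∃ q c, p = q ++ [c] := ⟨_, _, (List.dropLast_append_getLast hp).symm⟩
    rw [List.append_nil, answers_stateAfter_concat]
    simp [length_answers_stateAfter]
  | append_singleton r c ih =>
    rw [← List.append_assoc, answers_stateAfter_concat, List.getElem?_append_left, ih]
    rw [length_answers_stateAfter, List.length_append]
    have := List.length_pos_iff.2 hp
    omega

/-- The reserved edges, in terms of the list `p` of arrivals in the sampling phase. -/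
def reserved (p : List (Fin n)) : Finset (Fin n × Fin m) :=
  (A p.toFinset).filter fun e => e.1 ∈ p ∧ p.count e.1 < k

lemma reservedEdges_stateAfter (p r : List (Fin n)) (c : Fin n) :
    reservedEdges k p.length (p ++ r ++ [c])
      (stateAfter I A k p.length (p ++ r ++ [c])).answers = reserved A k p := by
  unfold reservedEdges reserved
  rw [List.append_assoc, List.take_left]
  rcases eq_or_ne p [] with rfl | hp
  · simp
  · rw [answers_stateAfter_append_getElem? _ _ _ _ _ _ hp, Option.getD_some]

lemma accepted_stateAfter_of_length_le (T : ℕ) (l : List (Fin n)) (hl : l.length ≤ T) :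
    (stateAfter I A k T l).accepted = ∅ := by
  induction l using List.reverseRecOn with
  | nil => rfl
  | append_singleton l c ih =>
    have hl' : l.length + 1 ≤ T := by simpa using hl
    rw [stateAfter_concat]
    simp [Policy.step, arrivals_stateAfter, samplingPolicy, hl', ih (by omega)]

/-- The accepted edges after the sampling phase `p` and the further arrivals `r`. -/
noncomputable def accepted (p r : List (Fin n)) : Finset (Fin n × Fin m) :=
  (stateAfter I A k p.length (p ++ r)).accepted

/-- The offline nodes that are proposed to the candidate `c` when it arrives after the sampling
phase `p` and the further arrivals `r`. -/
def proposals (p r : List (Fin n)) (c : Fin n) : Set (Fin m) :=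
  {v | ((c, v) ∈ reserved A k p) ∨
    (c ∉ p ∧ c ∉ r ∧ (c, v) ∈ A (p ++ r ++ [c]).toFinset ∧ ∀ e ∈ reserved A k p, e.2 ≠ v)}

variable {I A}

lemma accepted_nil (p : List (Fin n)) : accepted I A k p [] = ∅ :=
  accepted_stateAfter_of_length_le _ _ _ _ _ (by simp)

variable (hA : ∀ S, I.IsMatchingOn S (A S))
include hA

lemma proposals_subsingleton (p r : List (Fin n)) (c : Fin n) :
    (proposals A k p r c).Subsingleton := by
  have key : ∀ S v v', (c, v) ∈ A S → (c, v') ∈ A S → v = v' := fun S v v' h h' =>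
    congrArg Prod.snd ((hA S).2.2 _ h _ h' (Or.inl rfl))
  have hres : ∀ v, (c, v) ∈ reserved A k p → c ∈ p ∧ (c, v) ∈ A p.toFinset := fun v h =>
    ⟨(Finset.mem_filter.1 h).2.1, (Finset.mem_filter.1 h).1⟩
  rintro v (hv | hv) v' (hv' | hv')
  · exact key _ _ _ (hres _ hv).2 (hres _ hv').2
  · exact absurd (hres _ hv).1 hv'.1
  · exact absurd (hres _ hv').1 hv.1
  · exact key _ _ _ hv.2.2.1 hv'.2.2.1

lemma mem_accepted_concat (p r : List (Fin n)) (c : Fin n) (e : Fin n × Fin m) :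
    e ∈ accepted I A k p (r ++ [c]) ↔ e ∈ accepted I A k p r ∨
      (e.1 = c ∧ e.2 ∈ proposals A k p r c ∧
        ∀ f ∈ accepted I A k p r, f.1 ≠ c ∧ f.2 ≠ e.2) := by
  classical
  have hdec : (samplingPolicy n m k p.length).decide (p ++ r ++ [c])
      (stateAfter I A k p.length (p ++ r ++ [c])).answers (accepted I A k p r) =
        pick (proposals A k p r c) := by
    simp only [samplingPolicy, reservedEdges_stateAfter]
    have hlast : (stateAfter I A k p.length (p ++ r ++ [c])).answers.getLastD ∅ =
        A (p ++ r ++ [c]).toFinset := by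
      rw [answers_stateAfter_concat]; simp
    rw [hlast, if_neg (by simp), List.getLast?_concat, List.dropLast_concat]
    rw [show (p ++ r ++ [c]).take p.length = p by simp]
    unfold proposals
    by_cases hp : c ∈ p
    · simp [hp]
    · have hres : ∀ v, (c, v) ∉ reserved A k p := fun v h => hp (Finset.mem_filter.1 h).2.1
      by_cases hr : c ∈ r
      · simp [hp, hr, hres, pick]
      · simp [hp, hr, hres]
  have hE : ∀ v ∈ proposals A k p r c, (c, v) ∈ I.E := by
    rintro v (hv | hv)
    · exact (hA _).1 (Finset.mem_filter.1 hv).1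
    · exact (hA _).1 hv.2.2.1
  have hstep : accepted I A k p (r ++ [c]) =
      match pick (proposals A k p r c) with
      | none => accepted I A k p r
      | some v =>
        if (c, v) ∈ I.E ∧ ∀ e ∈ accepted I A k p r, e.1 ≠ c ∧ e.2 ≠ v then
          insert (c, v) (accepted I A k p r) else accepted I A k p r := by
    have hans := answers_stateAfter_concat I A k p.length (p ++ r) c
    rw [← hdec]
    unfold accepted
    rw [← List.append_assoc, hans, stateAfter_concat]
    simp only [Policy.step, arrivals_stateAfter]
    rw [show (samplingPolicy n m k p.length).query (p ++ r ++ [c])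
      (stateAfter I A k p.length (p ++ r)).answers (stateAfter I A k p.length (p ++ r)).accepted ∩
      (p ++ r ++ [c]).toFinset = (p ++ r ++ [c]).toFinset from Finset.inter_self _]
  rw [hstep]
  have hsub := proposals_subsingleton k hA p r c
  cases hpick : pick (proposals A k p r c) with
  | none =>
    have : ∀ v, v ∉ proposals A k p r c := fun v hv => by
      rw [← pick_eq_some_iff hsub, hpick] at hv; cases hv
    simp [this]
  | some v =>
    have hv := (pick_eq_some_iff hsub).1 hpick
    have heq : ∀ v', v' ∈ proposals A k p r c ↔ v' = v := fun v' =>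
      ⟨fun h => hsub h hv, fun h => h ▸ hv⟩
    obtain ⟨a, b⟩ := e
    simp only [heq, hE v hv, true_and]
    split_ifs with hfree
    · rw [Finset.mem_insert, Prod.mk.injEq]
      constructor
      · rintro (⟨rfl, rfl⟩ | h)
        · exact Or.inr ⟨rfl, rfl, hfree⟩
        · exact Or.inl h
      · rintro (h | ⟨rfl, rfl, _⟩)
        · exact Or.inr h
        · exact Or.inl ⟨rfl, rfl⟩
    · constructor
      · exact Or.inl
      · rintro (h | ⟨rfl, rfl, h⟩)
        · exact h
        · exact absurd h hfree

/-- Reserved offline nodes are kept for their reserved edges. -/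
lemma accepted_invariant (p r : List (Fin n)) :
    ∀ e ∈ accepted I A k p r, e ∈ reserved A k p ∨
      (e.1 ∉ p ∧ e.1 ∈ r ∧ ∀ f ∈ reserved A k p, f.2 ≠ e.2) := by
  induction r using List.reverseRecOn with
  | nil => simp [accepted_nil]
  | append_singleton r c ih =>
    intro e he
    obtain he | ⟨rfl, h | h, -⟩ := (mem_accepted_concat k hA p r c e).1 he
    · refine (ih e he).imp id fun h => ⟨h.1, ?_, h.2.2⟩
      simp [h.2.1]
    · exact Or.inl h
    · exact Or.inr ⟨h.1, by simp, h.2.2.2⟩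

lemma reserved_subset_accepted (p r : List (Fin n)) :
    ∀ e ∈ reserved A k p, e.1 ∈ r → e ∈ accepted I A k p r := by
  induction r using List.reverseRecOn with
  | nil => simp
  | append_singleton r c ih =>
    intro e he her
    rw [mem_accepted_concat k hA]
    by_cases hacc : e ∈ accepted I A k p r
    · exact Or.inl hacc
    have hc : e.1 = c := by
      by_contra hne
      exact hacc (ih e he (by simpa [hne] using her))
    subst hc
    refine Or.inr ⟨rfl, Or.inl he, fun f hf => ?_⟩
    have he' := Finset.mem_filter.1 he
    rcases accepted_invariant k hA p r f hf with hres | ⟨hp, -, hcov⟩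
    · have key : f.1 = e.1 ∨ f.2 = e.2 → f = e :=
        (hA _).2.2 f (Finset.mem_filter.1 hres).1 e he'.1
      exact ⟨fun h => hacc (key (Or.inl h) ▸ hf), fun h => hacc (key (Or.inr h) ▸ hf)⟩
    · exact ⟨fun h => hp (h ▸ he'.2.1), fun h => hcov e he h.symm⟩

end Algorithm

/-! ### The expected value of a run on randomly relabelled arrivals -/

section Value

variable {n m : ℕ} (I : Instance n m) (A : Finset (Fin n) → Finset (Fin n × Fin m)) (k : ℕ)

/-- The offline node `v` is neither reserved nor matched after the sampling phase `p` and the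
further arrivals `r`. -/
def IsFree (p r : List (Fin n)) (v : Fin m) : Prop :=
  (∀ e ∈ reserved A k p, e.2 ≠ v) ∧ ∀ e ∈ accepted I A k p r, e.2 ≠ v

/-- The candidates that have used up their `k` arrivals in the sampling phase `p`. -/
def exhausted (p : List (Fin n)) : Finset (Fin n) :=
  p.toFinset.filter fun c => k ≤ p.count c

lemma exhausted_subset (p : List (Fin n)) : exhausted k p ⊆ p.toFinset :=
  Finset.filter_subset _ _

lemma card_exhausted_le (p r : List (Fin n)) :
    (exhausted k p).card ≤ (p ++ r).toFinset.card :=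
  Finset.card_le_card fun x hx => by
    simpa using Or.inl (List.mem_toFinset.1 (exhausted_subset k p hx))

variable {I A} (hA : ∀ S, I.IsMatchingOn S (A S))

include hA in
lemma isFree_concat {p r : List (Fin n)} {v : Fin m} (hv : IsFree I A k p r v) (c : Fin n)
    (hc : c ∉ p → c ∉ r → (c, v) ∉ A (p ++ r ++ [c]).toFinset) :
    IsFree I A k p (r ++ [c]) v := by
  refine ⟨hv.1, fun e he hev => ?_⟩
  obtain he | ⟨rfl, h | h, -⟩ := (mem_accepted_concat k hA p r c e).1 he
  · exact hv.2 e he hev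
  · exact hv.1 _ h hev
  · exact hc h.1 h.2.1 (hev ▸ h.2.2.1)

lemma toFinset_map_image (g : Equiv.Perm (Fin n)) (l : List (Fin n)) :
    (l.map g).toFinset = l.toFinset.image g := by
  ext; simp

lemma mem_reserved_map (g : Equiv.Perm (Fin n)) (p : List (Fin n)) (c : Fin n) (v : Fin m) :
    (g c, v) ∈ reserved A k (p.map g) ↔
      c ∈ p.toFinset \ exhausted k p ∧ (g c, v) ∈ A (p.toFinset.image g) := by
  simp only [reserved, exhausted, Finset.mem_filter, Finset.mem_sdiff, toFinset_map_image,
    List.count_map_of_injective _ _ g.injective, List.mem_map_of_injective g.injective,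
    List.mem_toFinset]
  constructor
  · rintro ⟨h1, h2, h3⟩; exact ⟨⟨h2, fun h => absurd h.2 (by omega)⟩, h1⟩
  · rintro ⟨⟨h1, h2⟩, h3⟩; exact ⟨h3, h1, by by_contra hcon; exact h2 ⟨h1, by omega⟩⟩

open Classical in
include hA in
/-- An offline node stays unreserved because the candidate to which the sample's matching assigns it
is exhausted with probability at least `|exhausted| / |sample|`. -/
lemma card_exhausted_mul_le_of_nil (p : List (Fin n)) (v : Fin m)
    (G : Equiv.Perm (Fin n) → ℝ) (hG0 : ∀ g, 0 ≤ G g) (hG : SwapInvariant p.toFinset G) :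
    ((exhausted k p).card : ℝ) * ∑ g, G g ≤
      p.toFinset.card * ∑ g : Equiv.Perm (Fin n),
        if IsFree I A k (p.map g) [] v then G g else 0 := by
  set W := p.toFinset with hW
  have hsub : W \ exhausted k p ⊆ W := Finset.sdiff_subset
  have havg := card_mul_sum_perm hsub
    (fun g y => G g * if (y, v) ∈ A (W.image g) then 1 else 0) (fun g a ha b hb => by
      dsimp only
      rw [hG g a ha b hb, show W.image (g * Equiv.swap a b) = W.image g from
        swapInvariant_image W g a ha b hb])
  have hup : ∑ g : Equiv.Perm (Fin n), ∑ y ∈ W.image g,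
      G g * (if (y, v) ∈ A (W.image g) then (1 : ℝ) else 0) ≤ ∑ g, G g := by
    refine Finset.sum_le_sum fun g _ => ?_
    rw [← Finset.mul_sum]
    exact mul_le_of_le_one_right (hG0 g) ((hA _).sum_indicator_le_one v _)
  have hlow : ∑ g, G g ≤ (∑ g : Equiv.Perm (Fin n),
      if IsFree I A k (p.map g) [] v then G g else 0) +
      ∑ g : Equiv.Perm (Fin n), ∑ z ∈ W \ exhausted k p,
        G g * (if (g z, v) ∈ A (W.image g) then (1 : ℝ) else 0) := by
    rw [← Finset.sum_add_distrib]
    refine Finset.sum_le_sum fun g _ => ?_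
    have hnn : ∀ z ∈ W \ exhausted k p,
        0 ≤ G g * (if (g z, v) ∈ A (W.image g) then (1 : ℝ) else 0) := fun z _ =>
      mul_nonneg (hG0 g) (by split_ifs <;> norm_num)
    split_ifs with hfree
    · exact le_add_of_nonneg_right (Finset.sum_nonneg hnn)
    · have : ∃ e ∈ reserved A k (p.map g), e.2 = v := by
        by_contra hcon
        push Not at hcon
        exact hfree ⟨hcon, by simp [accepted_nil]⟩
      obtain ⟨⟨y, v'⟩, he, rfl⟩ := this
      obtain ⟨z, rfl⟩ := g.surjective y
      rw [mem_reserved_map] at he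
      have := Finset.single_le_sum hnn he.1
      rw [if_pos he.2, mul_one] at this
      linarith
  have hcard : ((W \ exhausted k p).card : ℝ) = W.card - (exhausted k p).card := by
    rw [Finset.card_sdiff_of_subset (exhausted_subset k p),
      Nat.cast_sub (Finset.card_le_card (exhausted_subset k p))]
  have h1 := mul_le_mul_of_nonneg_left hlow (Nat.cast_nonneg (α := ℝ) W.card)
  rw [mul_add, havg] at h1
  have h2 := mul_le_mul_of_nonneg_left hup (Nat.cast_nonneg (α := ℝ) (W \ exhausted k p).card)
  rw [hcard] at h1 h2
  linarith

open Classical in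
include hA in
/-- After the candidates `s` have been seen, an offline node is free with probability at least
`|exhausted| / |s|`, even under a weighting `G` that depends only on which candidates are in `s` and
on the later arrivals. -/
lemma card_exhausted_mul_le (p r : List (Fin n)) (v : Fin m)
    (G : Equiv.Perm (Fin n) → ℝ) (hG0 : ∀ g, 0 ≤ G g) (hG : SwapInvariant (p ++ r).toFinset G) :
    ((exhausted k p).card : ℝ) * ∑ g, G g ≤
      (p ++ r).toFinset.card * ∑ g : Equiv.Perm (Fin n),
        if IsFree I A k (p.map g) (r.map g) v then G g else 0 := by
  induction r using List.reverseRecOn generalizing G with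
  | nil =>
    rw [List.append_nil] at hG
    simpa using card_exhausted_mul_le_of_nil k hA p v G hG0 hG
  | append_singleton r c ih =>
    rw [← List.append_assoc] at hG ⊢
    set X := (p ++ r).toFinset with hX
    have hX' : (p ++ r ++ [c]).toFinset = insert c X := by
      ext; simp [hX]
    have himage : ∀ g : Equiv.Perm (Fin n),
        (p.map g ++ r.map g ++ [g c]).toFinset = (insert c X).image g := by
      intro g
      rw [← hX', ← toFinset_map_image]
      simp
    by_cases hc : c ∈ X
    · rw [hX', Finset.insert_eq_of_mem hc] at hG ⊢
      refine (ih G hG0 hG).trans (mul_le_mul_of_nonneg_left ?_ (Nat.cast_nonneg _))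
      refine Finset.sum_le_sum fun g _ => ?_
      by_cases hfree : IsFree I A k (p.map g) (r.map g) v
      · rw [if_pos hfree, if_pos]
        rw [List.map_append]
        refine isFree_concat k hA hfree (g c) fun hp hr => absurd hc ?_
        rw [List.mem_map_of_injective g.injective] at hp hr
        simp [hX, hp, hr]
      · rw [if_neg hfree]
        split_ifs
        exacts [hG0 g, le_rfl]
    · -- The newcomer blocks `v` with probability at most `1 / (|X| + 1)`.
      rw [hX'] at hG ⊢
      let G' : Equiv.Perm (Fin n) → ℝ := fun g =>
        if (g c, v) ∈ A ((insert c X).image g) then 0 else G g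
      have hG'0 : ∀ g, 0 ≤ G' g := fun g => by
        dsimp only [G']; split_ifs
        exacts [le_rfl, hG0 g]
      have hG' : SwapInvariant X G' := by
        intro g a ha b hb
        have hne : ∀ x ∈ X, c ≠ x := fun x hx h => hc (h ▸ hx)
        dsimp only [G']
        rw [hG.mono (Finset.subset_insert _ _) g a ha b hb,
          show (insert c X).image (g * Equiv.swap a b) = (insert c X).image g from
            (swapInvariant_image (insert c X)).mono (Finset.subset_insert _ _) g a ha b hb,
          Equiv.Perm.mul_apply, Equiv.swap_apply_of_ne_of_ne (hne a ha) (hne b hb)]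
      have h1 := ih G' hG'0 hG'
      have h2 : ∑ g : Equiv.Perm (Fin n),
          (if IsFree I A k (p.map g) (r.map g) v then G' g else 0) ≤
          ∑ g : Equiv.Perm (Fin n),
            if IsFree I A k (p.map g) ((r ++ [c]).map g) v then G g else 0 := by
        refine Finset.sum_le_sum fun g _ => ?_
        dsimp only [G']
        have hnn : (0 : ℝ) ≤ if IsFree I A k (p.map g) ((r ++ [c]).map g) v then G g else 0 := by
          split_ifs
          exacts [hG0 g, le_rfl]
        split_ifs at * with hfree hmem hfree' hfree' hfree' <;> try assumption
        · exact le_rfl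
        · refine absurd ?_ hfree'
          rw [List.map_append]
          refine isFree_concat k hA hfree (g c) fun _ _ => ?_
          rwa [himage]
      have havg := card_mul_sum_perm (X := insert c X) (Z := {c}) (by simp)
        (fun g y => G g * if (y, v) ∈ A ((insert c X).image g) then 1 else 0)
        (fun g a ha b hb => by
          dsimp only
          rw [hG g a ha b hb, show (insert c X).image (g * Equiv.swap a b) = (insert c X).image g
            from swapInvariant_image (insert c X) g a ha b hb])
      have hup : ∑ g : Equiv.Perm (Fin n), ∑ y ∈ (insert c X).image g,
          G g * (if (y, v) ∈ A ((insert c X).image g) then (1 : ℝ) else 0) ≤ ∑ g, G g := by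
        refine Finset.sum_le_sum fun g _ => ?_
        rw [← Finset.mul_sum]
        exact mul_le_of_le_one_right (hG0 g) ((hA _).sum_indicator_le_one v _)
      have hsplit : ∑ g, G g = ∑ g, G' g + ∑ g : Equiv.Perm (Fin n), ∑ z ∈ {c},
          G g * (if (g z, v) ∈ A ((insert c X).image g) then (1 : ℝ) else 0) := by
        rw [← Finset.sum_add_distrib]
        refine Finset.sum_congr rfl fun g _ => ?_
        rw [Finset.sum_singleton]
        dsimp only [G']
        split_ifs <;> simp
      rw [Finset.card_singleton, Nat.cast_one, one_mul] at havg
      rw [Finset.card_insert_of_notMem hc] at havg ⊢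
      push_cast at havg ⊢
      have hKX : ((exhausted k p).card : ℝ) ≤ X.card := by
        exact_mod_cast card_exhausted_le k p r
      set K := ((exhausted k p).card : ℝ) with hK
      have hK0 : 0 ≤ K := Nat.cast_nonneg _
      have hF0 : 0 ≤ ∑ g : Equiv.Perm (Fin n),
          if IsFree I A k (p.map g) ((r ++ [c]).map g) v then G g else 0 :=
        Finset.sum_nonneg fun g _ => by
          split_ifs
          exacts [hG0 g, le_rfl]
      set F := ∑ g : Equiv.Perm (Fin n),
          if IsFree I A k (p.map g) ((r ++ [c]).map g) v then G g else 0 with hF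
      have hs0 : (0 : ℝ) ≤ X.card := Nat.cast_nonneg _
      rcases hs0.eq_or_lt with hs | hs
      · rw [← hs] at hKX ⊢
        rw [le_antisymm hKX hK0]
        linarith
      · have h3 : K * ∑ g, G' g ≤ X.card * F := h1.trans (mul_le_mul_of_nonneg_left h2 hs0)
        have h4 : X.card * ∑ g, G g ≤ (X.card + 1) * ∑ g, G' g := by
          have := congrArg (fun x => ((X.card : ℝ) + 1) * x) hsplit
          rw [mul_add, havg] at this
          linarith
        refine le_of_mul_le_mul_left ?_ hs
        calc X.card * (K * ∑ g, G g) = K * (X.card * ∑ g, G g) := by ring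
          _ ≤ K * ((X.card + 1) * ∑ g, G' g) := mul_le_mul_of_nonneg_left h4 hK0
          _ = (X.card + 1) * (K * ∑ g, G' g) := by ring
          _ ≤ (X.card + 1) * (X.card * F) := mul_le_mul_of_nonneg_left h3 (by linarith)
          _ = X.card * ((X.card + 1) * F) := by ring

/-- If a newcomer of mean value `V ≥ α * O / N` gains on average `F ≥ (K / s) * V`, then `F` is at
least `α * O / N` times the increment of `K * log`, because `1 / s ≥ log (s + 1) - log s`. -/
lemma mul_log_succ_sub_log_le {s : ℕ} {K O α N V F : ℝ} (hK : 0 ≤ K) (hKs : K ≤ s)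
    (hO : 0 ≤ α * O) (hV : α * O ≤ N * V) (hF : K * V ≤ s * F) (hN : 0 ≤ N) (hF0 : 0 ≤ F) :
    α * (K * (Real.log (s + 1) - Real.log s) * O) ≤ N * F := by
  have hs0 : (0 : ℝ) ≤ s := Nat.cast_nonneg _
  rcases hs0.eq_or_lt with hs | hs
  · have hK' : K = 0 := le_antisymm (hs ▸ hKs) hK
    rw [hK', zero_mul, zero_mul, mul_zero]
    exact mul_nonneg hN hF0
  · have hlog : s * (Real.log (s + 1) - Real.log s) ≤ 1 := by
      rw [← Real.log_div (by positivity) hs.ne']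
      have h := Real.log_le_sub_one_of_pos (x := ((s : ℝ) + 1) / s) (by positivity)
      have h' : ((s : ℝ) + 1) / s - 1 = 1 / s := by field_simp; ring
      rw [h'] at h
      calc (s : ℝ) * Real.log (((s : ℝ) + 1) / s) ≤ s * (1 / s) := mul_le_mul_of_nonneg_left h hs0
        _ = 1 := by field_simp
    refine le_of_mul_le_mul_left ?_ hs
    calc s * (α * (K * (Real.log (s + 1) - Real.log s) * O))
        = (s * (Real.log (s + 1) - Real.log s)) * (K * (α * O)) := by ring
      _ ≤ 1 * (K * (α * O)) := mul_le_mul_of_nonneg_right hlog (mul_nonneg hK hO)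
      _ = K * (α * O) := one_mul _
      _ ≤ K * (N * V) := mul_le_mul_of_nonneg_left hV hK
      _ = N * (K * V) := by ring
      _ ≤ N * (s * F) := mul_le_mul_of_nonneg_left hF hN
      _ = s * (N * F) := by ring

variable {α : ℝ} (hα : 0 ≤ α) (hAα : I.IsApprox α A)

include hα hAα in
/-- On average over the relabellings, the oracle's matching of the candidates `X` has at least
`|X| / n` times `α` times the weight of an optimal matching. -/
lemma mul_card_mul_opt_le_sum_weight (X : Finset (Fin n)) :
    α * (X.card * (n.factorial * I.opt Finset.univ)) ≤
      n * ∑ g : Equiv.Perm (Fin n), (I.weight (A (X.image g)) : ℝ) := by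
  calc α * (X.card * (n.factorial * I.opt Finset.univ))
      ≤ α * (n * ∑ g : Equiv.Perm (Fin n), (I.opt (X.image g) : ℝ)) :=
        mul_le_mul_of_nonneg_left (I.card_mul_opt_le_sum_opt_image X) hα
    _ = n * ∑ g : Equiv.Perm (Fin n), α * (I.opt (X.image g) : ℝ) := by
        rw [← Finset.mul_sum]; ring
    _ ≤ _ := mul_le_mul_of_nonneg_left
        (Finset.sum_le_sum fun g _ => (hAα _).2) (Nat.cast_nonneg _)

include hα hAα in
/-- The candidates `Z ⊆ X` receive on average a fraction `|Z| / |X|` of the oracle's matching of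
`X`, and hence a fraction `|Z| / n` of `α` times the weight of an optimal matching. -/
lemma mul_card_mul_opt_le_sum_valueAt {X Z : Finset (Fin n)} (hZ : Z ⊆ X) :
    α * (Z.card * (n.factorial * I.opt Finset.univ)) ≤
      n * ∑ g : Equiv.Perm (Fin n), ∑ z ∈ Z, I.valueAt (A (X.image g)) (g z) := by
  rcases X.eq_empty_or_nonempty with rfl | hX
  · rw [Finset.subset_empty.1 hZ]; simp
  have hX0 : (0 : ℝ) < X.card := by exact_mod_cast hX.card_pos
  have havg := card_mul_sum_perm hZ (fun g y => I.valueAt (A (X.image g)) y)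
    (fun g a ha b hb => by
      dsimp only
      rw [show X.image (g * Equiv.swap a b) = X.image g from swapInvariant_image X g a ha b hb])
  have hsum : ∀ g : Equiv.Perm (Fin n), ∑ y ∈ X.image g, I.valueAt (A (X.image g)) y =
      I.weight (A (X.image g)) := fun g => (I.weight_eq_sum_valueAt (hAα _).1.2.1).symm
  simp only [hsum] at havg
  refine le_of_mul_le_mul_left ?_ hX0
  calc X.card * (α * (Z.card * (n.factorial * I.opt Finset.univ)))
      = Z.card * (α * (X.card * (n.factorial * I.opt Finset.univ))) := by ring
    _ ≤ Z.card * (n * ∑ g : Equiv.Perm (Fin n), (I.weight (A (X.image g)) : ℝ)) :=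
        mul_le_mul_of_nonneg_left (mul_card_mul_opt_le_sum_weight hα hAα X) (Nat.cast_nonneg _)
    _ = n * (Z.card * ∑ g : Equiv.Perm (Fin n), (I.weight (A (X.image g)) : ℝ)) := by ring
    _ = _ := by rw [← havg]; ring

lemma valueAt_mono {M M' : Finset (Fin n × Fin m)} {c : Fin n}
    (h : ∀ v, (c, v) ∈ M → (c, v) ∈ M') : I.valueAt M c ≤ I.valueAt M' c := by
  refine Finset.sum_le_sum fun v _ => ?_
  split_ifs with h1 h2 h2
  exacts [le_rfl, absurd (h v h1) h2, NNReal.coe_nonneg _, le_rfl]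

open Classical in
include hA in
/-- A candidate that first arrives after the sampling phase is matched along the oracle's edge if
the offline node of that edge is free. -/
lemma sum_valueAt_concat_ge {p r : List (Fin n)} {c : Fin n} (hp : c ∉ p) (hr : c ∉ r) :
    ∑ y ∈ r.toFinset \ p.toFinset, I.valueAt (accepted I A k p r) y +
      ∑ v, (if IsFree I A k p r v then
        (if (c, v) ∈ A (p ++ r ++ [c]).toFinset then (I.w (c, v) : ℝ) else 0) else 0) ≤
    ∑ y ∈ (r ++ [c]).toFinset \ p.toFinset, I.valueAt (accepted I A k p (r ++ [c])) y := by
  have hset : (r ++ [c]).toFinset \ p.toFinset = insert c (r.toFinset \ p.toFinset) := by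
    ext y
    simp only [Finset.mem_sdiff, List.mem_toFinset, List.mem_append, List.mem_singleton,
      Finset.mem_insert]
    constructor
    · tauto
    · rintro (rfl | h) <;> tauto
  rw [hset, Finset.sum_insert (by simp [hr]), add_comm]
  refine add_le_add ?_ (Finset.sum_le_sum fun y _ => valueAt_mono fun v h =>
    (mem_accepted_concat k hA p r c _).2 (Or.inl h))
  refine Finset.sum_le_sum fun v _ => ?_
  by_cases hv : IsFree I A k p r v ∧ (c, v) ∈ A (p ++ r ++ [c]).toFinset
  · rw [if_pos hv.1, if_pos hv.2, if_pos]
    refine (mem_accepted_concat k hA p r c _).2 (Or.inr ⟨rfl, Or.inr ⟨hp, hr, hv.2, hv.1.1⟩, ?_⟩)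
    refine fun f hf => ⟨fun hfc => ?_, hv.1.2 f hf⟩
    rcases accepted_invariant k hA p r f hf with h | h
    · exact hp (hfc ▸ (Finset.mem_filter.1 h).2.1)
    · exact hr (hfc ▸ h.2.1)
  · have h0 : (if IsFree I A k p r v then
        (if (c, v) ∈ A (p ++ r ++ [c]).toFinset then (I.w (c, v) : ℝ) else 0) else 0) = 0 := by
      split_ifs <;> tauto
    rw [h0]
    split_ifs <;> positivity

include hα hAα in
/-- The expected value gained from the candidates that first arrive after the sampling phase. -/
lemma mul_log_le_sum_valueAt_new (p r : List (Fin n)) :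
    α * ((exhausted k p).card * (Real.log (p ++ r).toFinset.card - Real.log p.toFinset.card) *
      (n.factorial * I.opt Finset.univ)) ≤
    n * ∑ g : Equiv.Perm (Fin n), ∑ y ∈ (r.map g).toFinset \ (p.map g).toFinset,
      I.valueAt (accepted I A k (p.map g) (r.map g)) y := by
  classical
  have hA : ∀ S, I.IsMatchingOn S (A S) := fun S => (hAα S).1
  induction r using List.reverseRecOn with
  | nil => simp
  | append_singleton r c ih =>
    rw [← List.append_assoc]
    set X := (p ++ r).toFinset with hX
    have hX' : (p ++ r ++ [c]).toFinset = insert c X := by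
      ext; simp [hX]
    rw [hX']
    by_cases hc : c ∈ X
    · rw [Finset.insert_eq_of_mem hc]
      refine ih.trans (mul_le_mul_of_nonneg_left (Finset.sum_le_sum fun g _ => ?_)
        (Nat.cast_nonneg _))
      rw [List.map_append]
      refine (Finset.sum_le_sum fun y _ => valueAt_mono fun v h =>
        (mem_accepted_concat k hA _ _ (g c) _).2 (Or.inl h)).trans ?_
      refine Finset.sum_le_sum_of_subset_of_nonneg ?_ fun _ _ _ => I.valueAt_nonneg _ _
      exact Finset.sdiff_subset_sdiff (fun y => by simp; tauto) le_rfl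
    · set gain : ℝ := ∑ v, ∑ g : Equiv.Perm (Fin n),
        (if IsFree I A k (p.map g) (r.map g) v then
          (if (g c, v) ∈ A ((insert c X).image g) then (I.w (g c, v) : ℝ) else 0) else 0)
        with hgain
      have hgain0 : 0 ≤ gain := Finset.sum_nonneg fun v _ => Finset.sum_nonneg fun g _ => by
        split_ifs <;> positivity
      have hc' : c ∉ p ∧ c ∉ r := by simpa [hX] using hc
      have hstep : (∑ g : Equiv.Perm (Fin n), ∑ y ∈ (r.map g).toFinset \ (p.map g).toFinset,
          I.valueAt (accepted I A k (p.map g) (r.map g)) y) + gain ≤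
          ∑ g : Equiv.Perm (Fin n), ∑ y ∈ ((r ++ [c]).map g).toFinset \ (p.map g).toFinset,
            I.valueAt (accepted I A k (p.map g) ((r ++ [c]).map g)) y := by
        rw [hgain, Finset.sum_comm, ← Finset.sum_add_distrib]
        refine Finset.sum_le_sum fun g _ => ?_
        have h := sum_valueAt_concat_ge k hA (p := p.map g) (r := r.map g) (c := g c)
          (by rw [List.mem_map_of_injective g.injective]; exact hc'.1)
          (by rw [List.mem_map_of_injective g.injective]; exact hc'.2)
        rw [show (p.map g ++ r.map g ++ [g c]).toFinset = (insert c X).image g by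
          rw [← hX', ← toFinset_map_image]; simp] at h
        rw [List.map_append]
        exact h
      -- The newcomer's edge is accepted with probability at least `|exhausted| / |X|`.
      have hfree : ((exhausted k p).card : ℝ) * ∑ g : Equiv.Perm (Fin n),
          I.valueAt (A ((insert c X).image g)) (g c) ≤ X.card * gain := by
        unfold Instance.valueAt
        rw [hgain, Finset.sum_comm, Finset.mul_sum, Finset.mul_sum]
        refine Finset.sum_le_sum fun v _ => card_exhausted_mul_le k hA p r v _ (fun g => ?_) ?_
        · split_ifs <;> positivity
        · intro g a ha b hb
          have hne : ∀ x ∈ X, c ≠ x := fun x hx h => hc (h ▸ hx)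
          dsimp only
          rw [show (insert c X).image (g * Equiv.swap a b) = (insert c X).image g from
            (swapInvariant_image (insert c X)).mono (Finset.subset_insert _ _) g a ha b hb,
            Equiv.Perm.mul_apply, Equiv.swap_apply_of_ne_of_ne (hne a ha) (hne b hb)]
      have hval := mul_card_mul_opt_le_sum_valueAt hα hAα (X := insert c X) (Z := {c}) (by simp)
      simp only [Finset.sum_singleton, Finset.card_singleton, Nat.cast_one, one_mul] at hval
      have hKX : ((exhausted k p).card : ℝ) ≤ X.card := by
        exact_mod_cast card_exhausted_le k p r
      rw [Finset.card_insert_of_notMem hc]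
      push_cast
      set K := ((exhausted k p).card : ℝ) with hK
      have hK0 : 0 ≤ K := Nat.cast_nonneg _
      set O : ℝ := n.factorial * I.opt Finset.univ with hO
      have hO0 : 0 ≤ O := by positivity
      have hnew : α * (K * (Real.log (X.card + 1) - Real.log X.card) * O) ≤ n * gain :=
        mul_log_succ_sub_log_le hK0 hKX (by positivity) hval hfree (Nat.cast_nonneg _) hgain0
      calc _ = α * (K * (Real.log X.card - Real.log p.toFinset.card) * O) +
            α * (K * (Real.log (X.card + 1) - Real.log X.card) * O) := by ring
        _ ≤ _ := add_le_add ih hnew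
        _ ≤ _ := by
            rw [← mul_add]
            exact mul_le_mul_of_nonneg_left hstep (Nat.cast_nonneg _)

include hα hAα in
/-- The expected value of a run whose arrival pattern is fixed up to a relabelling of the
candidates. -/
lemma le_sum_weight_accepted (hk : 0 < k) (p r : List (Fin n))
    (hcount : ∀ c, (p ++ r).count c = k) :
    α * (((p.toFinset.card - (exhausted k p).card : ℝ) +
      (exhausted k p).card * (Real.log n - Real.log p.toFinset.card)) *
        (n.factorial * I.opt Finset.univ)) ≤
    n * ∑ g : Equiv.Perm (Fin n), (I.weight (accepted I A k (p.map g) (r.map g)) : ℝ) := by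
  classical
  have hA : ∀ S, I.IsMatchingOn S (A S) := fun S => (hAα S).1
  have hall : (p ++ r).toFinset = Finset.univ := by
    ext c
    simpa using List.count_pos_iff.1 (by rw [hcount c]; exact hk : 0 < (p ++ r).count c)
  have hnew := mul_log_le_sum_valueAt_new k hα hAα p r
  rw [hall, Finset.card_univ, Fintype.card_fin] at hnew
  have hold := mul_card_mul_opt_le_sum_valueAt hα hAα
    (X := p.toFinset) (Z := p.toFinset \ exhausted k p) Finset.sdiff_subset
  rw [Finset.card_sdiff_of_subset (exhausted_subset k p),
    Nat.cast_sub (Finset.card_le_card (exhausted_subset k p))] at hold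
  have hsplit : ∀ g : Equiv.Perm (Fin n),
      ∑ z ∈ p.toFinset \ exhausted k p, I.valueAt (A (p.toFinset.image g)) (g z) +
        ∑ y ∈ (r.map g).toFinset \ (p.map g).toFinset,
          I.valueAt (accepted I A k (p.map g) (r.map g)) y ≤
      I.weight (accepted I A k (p.map g) (r.map g)) := by
    intro g
    rw [I.weight_eq_sum_valueAt (S := Finset.univ) fun e _ => Finset.mem_univ _]
    calc _ ≤ ∑ y ∈ (p.toFinset \ exhausted k p).image g,
            I.valueAt (accepted I A k (p.map g) (r.map g)) y +
          ∑ y ∈ (r.map g).toFinset \ (p.map g).toFinset,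
            I.valueAt (accepted I A k (p.map g) (r.map g)) y := by
          gcongr
          rw [Finset.sum_image fun a _ b _ h => g.injective h]
          refine Finset.sum_le_sum fun z hz => valueAt_mono fun v hv => ?_
          refine reserved_subset_accepted k hA _ _ _ ((mem_reserved_map k g p z v).2 ⟨hz, hv⟩) ?_
          -- A candidate of the sample that is not exhausted occurs among the later arrivals.
          have hz' : z ∈ p ∧ p.count z < k := by
            simp only [exhausted, Finset.mem_sdiff, Finset.mem_filter, List.mem_toFinset] at hz
            exact ⟨hz.1, by by_contra hcon; exact hz.2 ⟨hz.1, by omega⟩⟩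
          have := hcount z
          rw [List.count_append] at this
          exact List.mem_map_of_mem (List.count_pos_iff.1 (by omega))
      _ = ∑ y ∈ (p.toFinset \ exhausted k p).image g ∪
            ((r.map g).toFinset \ (p.map g).toFinset),
            I.valueAt (accepted I A k (p.map g) (r.map g)) y := by
          refine (Finset.sum_union ?_).symm
          rw [toFinset_map_image g p]
          exact Finset.disjoint_sdiff.mono_left (Finset.image_subset_image Finset.sdiff_subset)
      _ ≤ _ := Finset.sum_le_sum_of_subset_of_nonneg (Finset.subset_univ _)
          fun _ _ _ => I.valueAt_nonneg _ _
  calc _ = α * ((p.toFinset.card - (exhausted k p).card : ℝ) *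
        (n.factorial * I.opt Finset.univ)) + α * ((exhausted k p).card *
          (Real.log n - Real.log p.toFinset.card) * (n.factorial * I.opt Finset.univ)) := by ring
    _ ≤ _ := add_le_add hold hnew
    _ ≤ _ := by
      rw [← mul_add, ← Finset.sum_add_distrib]
      exact mul_le_mul_of_nonneg_left (Finset.sum_le_sum fun g _ => hsplit g) (Nat.cast_nonneg _)

end Value

/-! ### Sampling phases of binomial length -/

section Bernoulli

variable {κ : Type*} [Fintype κ]

/-- The expectation of `Φ` on a random subset of `κ` that contains each element independently with
probability `p`. -/
def bernoulliMean (p : ℝ) (Φ : Finset κ → ℝ) : ℝ :=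
  ∑ s, p ^ s.card * (1 - p) ^ (Fintype.card κ - s.card) * Φ s

lemma bernoulliMean_mono {p : ℝ} (hp0 : 0 ≤ p) (hp1 : p ≤ 1) {Φ Ψ : Finset κ → ℝ}
    (h : ∀ s, Φ s ≤ Ψ s) : bernoulliMean p Φ ≤ bernoulliMean p Ψ :=
  Finset.sum_le_sum fun s _ => mul_le_mul_of_nonneg_left (h s)
    (mul_nonneg (pow_nonneg hp0 _) (pow_nonneg (by linarith) _))

lemma bernoulliMean_add (p : ℝ) (Φ Ψ : Finset κ → ℝ) :
    bernoulliMean p (fun s => Φ s + Ψ s) = bernoulliMean p Φ + bernoulliMean p Ψ := by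
  simp only [bernoulliMean, mul_add, Finset.sum_add_distrib]

lemma bernoulliMean_const_mul (p a : ℝ) (Φ : Finset κ → ℝ) :
    bernoulliMean p (fun s => a * Φ s) = a * bernoulliMean p Φ := by
  simp only [bernoulliMean, Finset.mul_sum]
  exact Finset.sum_congr rfl fun s _ => by ring

lemma bernoulliMean_sum {ι : Type*} (p : ℝ) (t : Finset ι) (Φ : ι → Finset κ → ℝ) :
    bernoulliMean p (fun s => ∑ i ∈ t, Φ i s) = ∑ i ∈ t, bernoulliMean p (Φ i) := by
  simp only [bernoulliMean, Finset.mul_sum]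
  exact Finset.sum_comm

variable [DecidableEq κ]

lemma bernoulliMean_indicator (p : ℝ) {B C : Finset κ} (h : Disjoint B C) :
    bernoulliMean p (fun s => if B ⊆ s ∧ Disjoint C s then 1 else 0) =
      p ^ B.card * (1 - p) ^ C.card := by
  have key := Finset.prod_add (fun i => if i ∈ C then 0 else p)
    (fun i => if i ∈ B then 0 else 1 - p) (Finset.univ : Finset κ)
  have hleft : ∏ i : κ, ((if i ∈ C then 0 else p) + (if i ∈ B then 0 else 1 - p)) =
      p ^ B.card * (1 - p) ^ C.card := by
    have : ∀ i : κ, ((if i ∈ C then 0 else p) + (if i ∈ B then 0 else 1 - p)) =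
        (if i ∈ B then p else 1) * (if i ∈ C then 1 - p else 1) := by
      intro i
      by_cases hB : i ∈ B
      · have hC : i ∉ C := Finset.disjoint_left.1 h hB
        simp [hB, hC]
      · by_cases hC : i ∈ C <;> simp [hB, hC]
    simp only [this, Finset.prod_mul_distrib, Finset.prod_ite_mem, Finset.univ_inter,
      Finset.prod_const]
  rw [← hleft, key, Finset.powerset_univ]
  refine Finset.sum_congr rfl fun s _ => ?_
  dsimp only
  split_ifs with hs
  · rw [mul_one]
    congr 1
    · rw [Finset.prod_congr rfl fun i hi => if_neg (Finset.disjoint_right.1 hs.2 hi),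
        Finset.prod_const]
    · rw [Finset.prod_congr rfl fun i hi =>
        if_neg fun hB => (Finset.mem_sdiff.1 hi).2 (hs.1 hB), Finset.prod_const,
        Finset.card_sdiff_of_subset (Finset.subset_univ s), Finset.card_univ]
  · rw [mul_zero, eq_comm, mul_eq_zero]
    rw [not_and_or, Finset.not_subset, Finset.not_disjoint_iff] at hs
    rcases hs with ⟨i, hB, hi⟩ | ⟨i, hC, hi⟩
    · exact Or.inr (Finset.prod_eq_zero (i := i) (by simpa using hi) (if_pos hB))
    · exact Or.inl (Finset.prod_eq_zero hi (if_pos hC))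

lemma bernoulliMean_const (p a : ℝ) : bernoulliMean p (fun _ : Finset κ => a) = a := by
  have h := bernoulliMean_indicator p (Finset.disjoint_empty_left (∅ : Finset κ))
  simp only [Finset.empty_subset, Finset.disjoint_empty_left, and_self, if_true, Finset.card_empty,
    pow_zero, mul_one] at h
  have := bernoulliMean_const_mul p a (fun _ : Finset κ => (1 : ℝ))
  rwa [h, mul_one] at this

/-- The set of the first `T` elements in the order `σ`. -/
def firstElements {N : ℕ} (σ : Fin N ≃ κ) (T : ℕ) : Finset κ :=
  ((List.ofFn σ).take T).toFinset

omit [Fintype κ] in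
lemma card_firstElements {N : ℕ} (σ : Fin N ≃ κ) {T : ℕ} (hT : T ≤ N) :
    (firstElements σ T).card = T := by
  rw [firstElements, List.toFinset_card_of_nodup]
  · simpa using hT
  · exact (List.nodup_ofFn.2 σ.injective).sublist (List.take_sublist _ _)

omit [Fintype κ] in
lemma firstElements_trans {N : ℕ} (σ : Fin N ≃ κ) (h : Equiv.Perm κ) (T : ℕ) :
    firstElements (σ.trans h) T = (firstElements σ T).image h := by
  have : List.ofFn (σ.trans h) = (List.ofFn σ).map h := by
    rw [List.map_ofFn]; rfl
  ext x
  rw [firstElements, firstElements, this, ← List.map_take]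
  simp only [List.mem_toFinset, List.mem_map, Finset.mem_image]

lemma exists_perm_image_eq {s s' : Finset κ} (h : s.card = s'.card) :
    ∃ f : Equiv.Perm κ, s.image f = s' := by
  have e : {x // x ∈ s} ≃ {x // x ∈ s'} := Fintype.equivOfCardEq (by simpa using h)
  refine ⟨e.extendSubtype, Finset.eq_of_subset_of_card_le ?_ ?_⟩
  · intro y hy
    obtain ⟨x, hx, rfl⟩ := Finset.mem_image.1 hy
    exact e.extendSubtype_mem x hx
  · rw [Finset.card_image_of_injective _ (Equiv.injective _), h]

/-- The first `T` elements of a uniformly random order form a uniformly random set of size `T`. -/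
lemma choose_mul_sum_firstElements {N : ℕ} (hN : Fintype.card κ = N) {T : ℕ} (hT : T ≤ N)
    (Φ : Finset κ → ℝ) :
    (N.choose T : ℝ) * ∑ σ : Fin N ≃ κ, Φ (firstElements σ T) =
      Fintype.card (Fin N ≃ κ) * ∑ s ∈ Finset.powersetCard T Finset.univ, Φ s := by
  classical
  let cnt : Finset κ → ℕ := fun s =>
    (Finset.univ.filter fun σ : Fin N ≃ κ => firstElements σ T = s).card
  have hmaps : ∀ σ ∈ (Finset.univ : Finset (Fin N ≃ κ)),
      firstElements σ T ∈ Finset.powersetCard T (Finset.univ : Finset κ) := fun σ _ =>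
    Finset.mem_powersetCard.2 ⟨Finset.subset_univ _, card_firstElements σ hT⟩
  have hcnt : ∀ s s' : Finset κ, s.card = s'.card → cnt s = cnt s' := by
    intro s s' h
    obtain ⟨f, rfl⟩ := exists_perm_image_eq h
    refine Finset.card_bij' (fun σ _ => σ.trans f) (fun σ _ => σ.trans f.symm) ?_ ?_ ?_ ?_
    · intro σ hσ
      simp only [Finset.mem_filter, Finset.mem_univ, true_and] at hσ ⊢
      rw [firstElements_trans, hσ]
    · intro σ hσ
      simp only [Finset.mem_filter, Finset.mem_univ, true_and] at hσ ⊢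
      rw [firstElements_trans, hσ, Finset.image_image]
      simp
    · intro σ _; ext; simp
    · intro σ _; ext; simp
  have hsum : ∑ σ : Fin N ≃ κ, Φ (firstElements σ T) =
      ∑ s ∈ Finset.powersetCard T (Finset.univ : Finset κ), cnt s * Φ s := by
    rw [← Finset.sum_fiberwise_of_maps_to hmaps]
    refine Finset.sum_congr rfl fun s _ => ?_
    rw [Finset.sum_congr rfl fun σ hσ => by rw [(Finset.mem_filter.1 hσ).2], Finset.sum_const,
      nsmul_eq_mul]
  have htotal : Fintype.card (Fin N ≃ κ) =
      ∑ s ∈ Finset.powersetCard T (Finset.univ : Finset κ), cnt s :=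
    Finset.card_eq_sum_card_fiberwise hmaps
  have hne : (Finset.powersetCard T (Finset.univ : Finset κ)).Nonempty :=
    Finset.powersetCard_nonempty.2 (by rw [Finset.card_univ, hN]; exact hT)
  obtain ⟨s₀, hs₀⟩ := hne
  have hconst : ∀ s ∈ Finset.powersetCard T (Finset.univ : Finset κ), cnt s = cnt s₀ :=
    fun s hs => hcnt s s₀ (by
      rw [(Finset.mem_powersetCard.1 hs).2, (Finset.mem_powersetCard.1 hs₀).2])
  rw [hsum, htotal, Finset.sum_congr rfl hconst, Finset.sum_const, Finset.card_powersetCard,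
    Finset.card_univ, hN, Finset.sum_congr rfl fun s hs => by rw [hconst s hs], ← Finset.mul_sum]
  rw [smul_eq_mul]
  push_cast
  ring

/-- If the length `T` of an initial segment of a uniformly random order has a binomial distribution,
then that segment contains the elements independently of each other. -/
lemma sum_binomial_mul_mean_firstElements {N : ℕ} (hN : Fintype.card κ = N) (p : ℝ)
    (Φ : Finset κ → ℝ) :
    ∑ T : Fin (N + 1), p ^ (T : ℕ) * (1 - p) ^ (N - T) * N.choose T *
      ((∑ σ : Fin N ≃ κ, Φ (firstElements σ T)) / Fintype.card (Fin N ≃ κ)) =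
    bernoulliMean p Φ := by
  have hcard : (Fintype.card (Fin N ≃ κ) : ℝ) ≠ 0 := by
    have : Nonempty (Fin N ≃ κ) := ⟨(Fintype.equivFinOfCardEq hN).symm⟩
    exact_mod_cast Fintype.card_ne_zero
  have hterm : ∀ T ∈ Finset.range (N + 1), p ^ T * (1 - p) ^ (N - T) * N.choose T *
      ((∑ σ : Fin N ≃ κ, Φ (firstElements σ T)) / Fintype.card (Fin N ≃ κ)) =
      ∑ s ∈ Finset.powersetCard T (Finset.univ : Finset κ),
        p ^ s.card * (1 - p) ^ (Fintype.card κ - s.card) * Φ s := by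
    intro T hT
    have hT' : T ≤ N := Nat.lt_succ_iff.1 (Finset.mem_range.1 hT)
    have h := choose_mul_sum_firstElements hN hT' Φ
    have hs : ∀ s ∈ Finset.powersetCard T (Finset.univ : Finset κ),
        p ^ s.card * (1 - p) ^ (Fintype.card κ - s.card) * Φ s =
        p ^ T * (1 - p) ^ (N - T) * Φ s := fun s hs => by
      rw [(Finset.mem_powersetCard.1 hs).2, hN]
    rw [Finset.sum_congr rfl hs, ← Finset.mul_sum, mul_assoc, ← mul_div_assoc, h, mul_comm
      (Fintype.card (Fin N ≃ κ) : ℝ), mul_div_cancel_right₀ _ hcard]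
  rw [Fin.sum_univ_eq_sum_range (fun T => p ^ T * (1 - p) ^ (N - T) * N.choose T *
      ((∑ σ : Fin N ≃ κ, Φ (firstElements σ T)) / Fintype.card (Fin N ≃ κ))) (N + 1),
    Finset.sum_congr rfl hterm, bernoulliMean, ← Finset.powerset_univ, Finset.sum_powerset,
    Finset.card_univ, hN]

end Bernoulli

/-! ### The composition of the sample -/

section Sample

variable {n k : ℕ}

/-- The candidates with at least one arrival in `S`. -/
def touched (S : Finset (Fin n × Fin k)) : Finset (Fin n) :=
  Finset.univ.filter fun c => ∃ i, (c, i) ∈ S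

/-- The candidates with all their arrivals in `S`. -/
def filled (S : Finset (Fin n × Fin k)) : Finset (Fin n) :=
  Finset.univ.filter fun c => ∀ i, (c, i) ∈ S

/-- The arrivals of the candidate `c`. -/
def arrivalsOf (k : ℕ) (c : Fin n) : Finset (Fin n × Fin k) :=
  {c} ×ˢ Finset.univ

lemma card_arrivalsOf (c : Fin n) : (arrivalsOf k c).card = k := by
  simp [arrivalsOf]

lemma arrivalsOf_subset_iff {S : Finset (Fin n × Fin k)} {c : Fin n} :
    arrivalsOf k c ⊆ S ↔ ∀ i, (c, i) ∈ S := by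
  simp [arrivalsOf, Finset.subset_iff]

lemma disjoint_arrivalsOf_iff {S : Finset (Fin n × Fin k)} {c : Fin n} :
    Disjoint (arrivalsOf k c) S ↔ ¬ ∃ i, (c, i) ∈ S := by
  simp [arrivalsOf, Finset.disjoint_left]

lemma disjoint_arrivalsOf {c d : Fin n} (h : c ≠ d) :
    Disjoint (arrivalsOf k c) (arrivalsOf k d) := by
  rw [disjoint_arrivalsOf_iff]
  simp [arrivalsOf, h.symm]

lemma card_filled (S : Finset (Fin n × Fin k)) :
    ((filled S).card : ℝ) = ∑ c, if arrivalsOf k c ⊆ S ∧ Disjoint ∅ S then (1 : ℝ) else 0 := by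
  simp [filled, arrivalsOf_subset_iff]

lemma card_touched (S : Finset (Fin n × Fin k)) :
    ((touched S).card : ℝ) =
      n - ∑ c, if ∅ ⊆ S ∧ Disjoint (arrivalsOf k c) S then (1 : ℝ) else 0 := by
  have h : ∀ c : Fin n, (if ∃ i, (c, i) ∈ S then (1 : ℝ) else 0) =
      1 - if ∅ ⊆ S ∧ Disjoint (arrivalsOf k c) S then (1 : ℝ) else 0 := by
    intro c
    by_cases hc : ∃ i, (c, i) ∈ S <;> simp [hc, disjoint_arrivalsOf_iff]
  rw [touched, Finset.card_filter]
  push_cast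
  rw [Finset.sum_congr rfl fun c _ => h c, Finset.sum_sub_distrib]
  simp

lemma bernoulliMean_filled (p : ℝ) :
    bernoulliMean p (fun S : Finset (Fin n × Fin k) => ((filled S).card : ℝ)) = n * p ^ k := by
  classical
  simp only [card_filled]
  rw [bernoulliMean_sum]
  simp only [bernoulliMean_indicator p (Finset.disjoint_empty_right _), card_arrivalsOf]
  simp

lemma bernoulliMean_touched (p : ℝ) :
    bernoulliMean p (fun S : Finset (Fin n × Fin k) => ((touched S).card : ℝ)) =
      n * (1 - (1 - p) ^ k) := by
  classical
  have h : (fun S : Finset (Fin n × Fin k) => ((touched S).card : ℝ)) = fun S =>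
      (n : ℝ) + (-1) * ∑ c, if ∅ ⊆ S ∧ Disjoint (arrivalsOf k c) S then (1 : ℝ) else 0 := by
    funext S
    rw [card_touched]
    ring
  rw [h, bernoulliMean_add, bernoulliMean_const, bernoulliMean_const_mul, bernoulliMean_sum]
  simp only [bernoulliMean_indicator p (Finset.disjoint_empty_left _), card_arrivalsOf]
  simp
  ring

lemma bernoulliMean_filled_mul_touched (hk : 0 < k) (p : ℝ) :
    bernoulliMean p (fun S : Finset (Fin n × Fin k) =>
      ((filled S).card : ℝ) * (touched S).card) =
      n * n * p ^ k - n * (n - 1) * (p ^ k * (1 - p) ^ k) := by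
  classical
  have h : (fun S : Finset (Fin n × Fin k) => ((filled S).card : ℝ) * (touched S).card) = fun S =>
      (n : ℝ) * (filled S).card + (-1) * ∑ c, ∑ d ∈ Finset.univ.erase c,
        if arrivalsOf k c ⊆ S ∧ Disjoint (arrivalsOf k d) S then (1 : ℝ) else 0 := by
    funext S
    have hdiag : ∀ c : Fin n, ∑ d ∈ Finset.univ.erase c,
        (if arrivalsOf k c ⊆ S ∧ Disjoint (arrivalsOf k d) S then (1 : ℝ) else 0) =
        ∑ d, (if arrivalsOf k c ⊆ S ∧ Disjoint ∅ S then (1 : ℝ) else 0) *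
          if ∅ ⊆ S ∧ Disjoint (arrivalsOf k d) S then (1 : ℝ) else 0 := by
      intro c
      rw [← Finset.add_sum_erase _ _ (Finset.mem_univ c)]
      have h0 : (if arrivalsOf k c ⊆ S ∧ Disjoint ∅ S then (1 : ℝ) else 0) *
          (if ∅ ⊆ S ∧ Disjoint (arrivalsOf k c) S then (1 : ℝ) else 0) = 0 := by
        by_cases hc : ∃ i, (c, i) ∈ S
        · rw [if_neg (c := ∅ ⊆ S ∧ _) fun h => disjoint_arrivalsOf_iff.1 h.2 hc, mul_zero]
        · rw [if_neg fun h => hc ⟨⟨0, hk⟩, arrivalsOf_subset_iff.1 h.1 _⟩, zero_mul]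
      rw [h0, zero_add]
      refine Finset.sum_congr rfl fun d _ => ?_
      by_cases hc : arrivalsOf k c ⊆ S <;> by_cases hd : Disjoint (arrivalsOf k d) S <;>
        simp [hc, hd]
    simp only [hdiag, ← Finset.mul_sum, ← Finset.sum_mul]
    rw [← card_filled, card_touched]
    ring
  rw [h, bernoulliMean_add, bernoulliMean_const_mul, bernoulliMean_const_mul,
    bernoulliMean_filled, bernoulliMean_sum]
  have hsum : ∀ c : Fin n, bernoulliMean p (fun S : Finset (Fin n × Fin k) =>
      ∑ d ∈ Finset.univ.erase c,
        if arrivalsOf k c ⊆ S ∧ Disjoint (arrivalsOf k d) S then (1 : ℝ) else 0) =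
      (n - 1) * (p ^ k * (1 - p) ^ k) := by
    intro c
    have hn : 1 ≤ n := Nat.one_le_iff_ne_zero.2 fun h => (h ▸ c).elim0
    rw [bernoulliMean_sum, Finset.sum_congr rfl fun d hd => by
      rw [bernoulliMean_indicator p (disjoint_arrivalsOf (Finset.ne_of_mem_erase hd).symm),
        card_arrivalsOf, card_arrivalsOf], Finset.sum_const,
      Finset.card_erase_of_mem (Finset.mem_univ c), Finset.card_univ, Fintype.card_fin,
      nsmul_eq_mul, Nat.cast_sub hn, Nat.cast_one]
  simp only [hsum, Finset.sum_const, Finset.card_univ, Fintype.card_fin, nsmul_eq_mul]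
  ring

/-- The tangent to the logarithm at the mean of `|touched| / n` reduces the expected value of the
algorithm to mixed moments of `|filled|` and `|touched|`. -/
lemma le_bernoulliMean_value (hk : 0 < k) (hn : 0 < n) {p : ℝ} (hp0 : 0 < p) (hp1 : p < 1) :
    n * (1 - p ^ k - (1 - p) ^ k - p ^ k * Real.log (1 - (1 - p) ^ k)) -
        p ^ k * (1 - p) ^ k / (1 - (1 - p) ^ k) ≤
      bernoulliMean p (fun S : Finset (Fin n × Fin k) =>
        ((touched S).card - (filled S).card : ℝ) +
          (filled S).card * (Real.log n - Real.log (touched S).card)) := by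
  set x : ℝ := 1 - (1 - p) ^ k with hx
  have hx0 : 0 < x := by
    have : (1 - p) ^ k < 1 := pow_lt_one₀ (by linarith) (by linarith) hk.ne'
    linarith
  have hn' : (0 : ℝ) < n := by exact_mod_cast hn
  have hpt : ∀ S : Finset (Fin n × Fin k),
      (touched S).card + ((-Real.log x) * (filled S).card +
        (-(1 / (n * x))) * ((filled S).card * (touched S).card : ℝ)) ≤
      ((touched S).card - (filled S).card : ℝ) +
          (filled S).card * (Real.log n - Real.log (touched S).card) := by
    intro S
    have hsub : filled S ⊆ touched S := fun c hc => by
      simp only [filled, touched, Finset.mem_filter, Finset.mem_univ, true_and] at hc ⊢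
      exact ⟨⟨0, hk⟩, hc _⟩
    have hle : ((filled S).card : ℝ) ≤ (touched S).card := by
      exact_mod_cast Finset.card_le_card hsub
    have hK : (0 : ℝ) ≤ (filled S).card := Nat.cast_nonneg _
    set K : ℝ := ((filled S).card : ℝ)
    set t : ℝ := ((touched S).card : ℝ)
    rcases hK.eq_or_lt with h0 | hpos
    · rw [← h0]; simp
    have ht : 0 < t := hpos.trans_le hle
    have hlog := Real.log_le_sub_one_of_pos (x := t / (n * x)) (by positivity)
    rw [Real.log_div ht.ne' (by positivity), Real.log_mul hn'.ne' hx0.ne'] at hlog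
    have := mul_le_mul_of_nonneg_left hlog hK
    have e : K * (t / (n * x) - 1) = 1 / (n * x) * (K * t) - K := by ring
    rw [e] at this
    linarith
  refine le_trans (le_of_eq ?_) (bernoulliMean_mono hp0.le hp1.le hpt)
  rw [bernoulliMean_add, bernoulliMean_add, bernoulliMean_const_mul, bernoulliMean_const_mul,
    bernoulliMean_filled_mul_touched hk, bernoulliMean_filled, bernoulliMean_touched]
  have hq : (1 - p) ^ k = 1 - x := by rw [hx]; ring
  rw [hq]
  field_simp
  ring

end Sample

/-! ### The approximation ratio -/

section Ratio

variable {n m k : ℕ}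

/-- The list of the arriving candidates. -/
def arrivalList (σ : ArrivalOrder k n) : List (Fin n) :=
  List.ofFn fun t => (σ t).1

lemma take_arrivalList (σ : ArrivalOrder k n) (T : ℕ) :
    (arrivalList σ).take T = ((List.ofFn σ).take T).map Prod.fst := by
  rw [List.map_take, List.map_ofFn]; rfl

lemma count_take_arrivalList (σ : ArrivalOrder k n) (T : ℕ) (c : Fin n) :
    ((arrivalList σ).take T).count c = ((firstElements σ T).filter fun e => e.1 = c).card := by
  have hnodup : ((List.ofFn σ).take T).Nodup :=
    (List.nodup_ofFn.2 σ.injective).sublist (List.take_sublist _ _)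
  have hset : (firstElements σ T).filter (fun e => e.1 = c) =
      (((List.ofFn σ).take T).filter fun e => e.1 = c).toFinset := by
    rw [firstElements, List.toFinset_filter]; simp
  rw [hset, List.toFinset_card_of_nodup (hnodup.filter _), take_arrivalList, List.count,
    List.countP_map, List.countP_eq_length_filter]
  rfl

lemma toFinset_take_arrivalList (σ : ArrivalOrder k n) (T : ℕ) :
    ((arrivalList σ).take T).toFinset = touched (firstElements σ T) := by
  ext c
  rw [take_arrivalList]
  simp only [touched, firstElements, List.mem_toFinset, List.mem_map, Finset.mem_filter,
    Finset.mem_univ, true_and]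
  exact ⟨fun ⟨e, he, hc⟩ => ⟨e.2, hc ▸ he⟩, fun ⟨i, hi⟩ => ⟨_, hi, rfl⟩⟩

lemma mem_arrivalsOf_iff {e : Fin n × Fin k} {c : Fin n} : e ∈ arrivalsOf k c ↔ e.1 = c := by
  rw [arrivalsOf, Finset.mem_product, Finset.mem_singleton]
  simp

lemma filter_fst_subset_arrivalsOf (S : Finset (Fin n × Fin k)) (c : Fin n) :
    (S.filter fun e => e.1 = c) ⊆ arrivalsOf k c :=
  fun _ he => mem_arrivalsOf_iff.2 (Finset.mem_filter.1 he).2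

lemma exhausted_take_arrivalList (hk : 0 < k) (σ : ArrivalOrder k n) (T : ℕ) :
    exhausted k ((arrivalList σ).take T) = filled (firstElements σ T) := by
  ext c
  rw [exhausted, Finset.mem_filter, count_take_arrivalList, filled, Finset.mem_filter,
    toFinset_take_arrivalList, ← arrivalsOf_subset_iff]
  have hsub := filter_fst_subset_arrivalsOf (firstElements σ T) c
  constructor
  · rintro ⟨-, h⟩
    refine ⟨Finset.mem_univ _, ?_⟩
    rw [← Finset.eq_of_subset_of_card_le hsub (by rwa [card_arrivalsOf])]
    exact Finset.filter_subset _ _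
  · rintro ⟨-, h⟩
    refine ⟨?_, ?_⟩
    · rw [touched, Finset.mem_filter]
      exact ⟨Finset.mem_univ _, ⟨0, hk⟩, arrivalsOf_subset_iff.1 h _⟩
    · refine (card_arrivalsOf (k := k) c).ge.trans (Finset.card_le_card fun e he => ?_)
      exact Finset.mem_filter.2 ⟨h he, mem_arrivalsOf_iff.1 he⟩

lemma count_arrivalList (σ : ArrivalOrder k n) (c : Fin n) : (arrivalList σ).count c = k := by
  have hlen : (arrivalList σ).take (n * k) = arrivalList σ :=
    List.take_of_length_le (by simp [arrivalList])
  have hall : firstElements σ (n * k) = Finset.univ :=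
    Finset.eq_univ_of_card _ (by rw [card_firstElements σ le_rfl]; simp)
  rw [← hlen, count_take_arrivalList, hall]
  conv_rhs => rw [← card_arrivalsOf (k := k) c]
  refine congrArg _ (Finset.Subset.antisymm (filter_fst_subset_arrivalsOf _ c) fun e he => ?_)
  exact Finset.mem_filter.2 ⟨Finset.mem_univ _, mem_arrivalsOf_iff.1 he⟩

/-- The order of arrivals after relabelling the candidates by `g`. -/
def relabel (g : Equiv.Perm (Fin n)) : Equiv.Perm (ArrivalOrder k n) where
  toFun σ := σ.trans (Equiv.prodCongr g (Equiv.refl _))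
  invFun σ := σ.trans (Equiv.prodCongr g.symm (Equiv.refl _))
  left_inv σ := by ext <;> simp
  right_inv σ := by ext <;> simp

lemma arrivalList_relabel (g : Equiv.Perm (Fin n)) (σ : ArrivalOrder k n) :
    arrivalList (relabel g σ) = (arrivalList σ).map g := by
  rw [arrivalList, arrivalList, List.map_ofFn]; rfl

variable {I : Instance n m} {A : Finset (Fin n) → Finset (Fin n × Fin m)}

lemma run_samplingPolicy (σ : ArrivalOrder k n) {T : ℕ} (hT : T ≤ n * k) :
    (samplingPolicy n m k T).run I A σ =
      accepted I A k ((arrivalList σ).take T) ((arrivalList σ).drop T) := by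
  have hlen : ((arrivalList σ).take T).length = T := by simpa [arrivalList] using hT
  rw [accepted, hlen, List.take_append_drop]
  rfl

/-- The expected value of the algorithm with a sampling phase of fixed length. -/
lemma le_sum_weight_run (hk : 0 < k) {α : ℝ} (hα : 0 ≤ α) (hA : I.IsApprox α A) {T : ℕ}
    (hT : T ≤ n * k) :
    α * I.opt Finset.univ * ∑ σ : ArrivalOrder k n,
      (((touched (firstElements σ T)).card - (filled (firstElements σ T)).card : ℝ) +
        (filled (firstElements σ T)).card *
          (Real.log n - Real.log (touched (firstElements σ T)).card)) ≤
    n * ∑ σ : ArrivalOrder k n, (I.weight ((samplingPolicy n m k T).run I A σ) : ℝ) := by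
  have hfac : (0 : ℝ) < n.factorial := by exact_mod_cast n.factorial_pos
  refine le_of_mul_le_mul_left ?_ hfac
  -- The uniform distribution of the order is invariant under relabelling the candidates.
  have hinv : (n.factorial : ℝ) * ∑ σ : ArrivalOrder k n,
      (I.weight ((samplingPolicy n m k T).run I A σ) : ℝ) =
      ∑ σ : ArrivalOrder k n, ∑ g : Equiv.Perm (Fin n),
        (I.weight ((samplingPolicy n m k T).run I A (relabel g σ)) : ℝ) := by
    rw [Finset.sum_comm]
    simp only [fun g : Equiv.Perm (Fin n) => Equiv.sum_comp (relabel g)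
      (fun σ : ArrivalOrder k n => (I.weight ((samplingPolicy n m k T).run I A σ) : ℝ))]
    rw [Finset.sum_const, Finset.card_univ, Fintype.card_perm, Fintype.card_fin, nsmul_eq_mul]
  rw [mul_left_comm _ (n : ℝ), hinv, Finset.mul_sum, Finset.mul_sum, Finset.mul_sum]
  refine Finset.sum_le_sum fun σ _ => ?_
  have h := le_sum_weight_accepted k hα hA hk ((arrivalList σ).take T) ((arrivalList σ).drop T)
    (fun c => by rw [List.take_append_drop, count_arrivalList])
  rw [toFinset_take_arrivalList, exhausted_take_arrivalList hk] at h
  simp only [run_samplingPolicy _ hT, arrivalList_relabel, ← List.map_take, ← List.map_drop]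
  exact le_trans (le_of_eq (by ring)) h

/-- The binomial distribution of the number of successes in `N` trials with success probability
`p`. -/
noncomputable def binomialPMF (N : ℕ) (p : ℝ) (hp0 : 0 ≤ p) (hp1 : p ≤ 1) : PMF (Fin (N + 1)) :=
  PMF.ofFintype (fun T => ENNReal.ofReal (p ^ (T : ℕ) * (1 - p) ^ (N - T) * N.choose T)) (by
    have h0 : 0 ≤ 1 - p := by linarith
    rw [← ENNReal.ofReal_sum_of_nonneg fun T _ => by positivity,
      Fin.sum_univ_eq_sum_range (fun T => p ^ T * (1 - p) ^ (N - T) * N.choose T) (N + 1),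
      ← add_pow]
    simp)

/-- The sampling policy with a sampling phase of binomial length. -/
noncomputable def samplingAlgorithm (n m k : ℕ) (p : ℝ) (hp0 : 0 ≤ p) (hp1 : p ≤ 1) :
    RandomizedAlgorithm n m where
  seeds := n * k + 1
  dist := binomialPMF (n * k) p hp0 hp1
  policy T := samplingPolicy n m k T

lemma mul_opt_le_expectedWeight (hk : 0 < k) (hn : 0 < n) {p : ℝ} (hp0 : 0 < p) (hp1 : p < 1)
    {α : ℝ} (hα : 0 ≤ α) (hA : I.IsApprox α A) :
    α * I.opt Finset.univ *
      (n * (1 - p ^ k - (1 - p) ^ k - p ^ k * Real.log (1 - (1 - p) ^ k)) -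
        p ^ k * (1 - p) ^ k / (1 - (1 - p) ^ k)) ≤
    n * (samplingAlgorithm n m k p hp0.le hp1.le).expectedWeight k I A := by
  refine (mul_le_mul_of_nonneg_left (le_bernoulliMean_value hk hn hp0 hp1)
    (mul_nonneg hα (NNReal.coe_nonneg _))).trans ?_
  have h0 : 0 ≤ 1 - p := by linarith
  have hdist : ∀ T : Fin (n * k + 1), ((binomialPMF (n * k) p hp0.le hp1.le) T).toReal =
      p ^ (T : ℕ) * (1 - p) ^ (n * k - T) * (n * k).choose T := fun T =>
    ENNReal.toReal_ofReal
      (mul_nonneg (mul_nonneg (pow_nonneg hp0.le _) (pow_nonneg h0 _)) (Nat.cast_nonneg _))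
  rw [← sum_binomial_mul_mean_firstElements (N := n * k) (by simp), Finset.mul_sum]
  unfold RandomizedAlgorithm.expectedWeight
  rw [Finset.mul_sum]
  refine Finset.sum_le_sum fun T _ => ?_
  change _ ≤ n * (((binomialPMF (n * k) p hp0.le hp1.le) T).toReal *
    ((∑ σ : ArrivalOrder k n, (I.weight ((samplingPolicy n m k T).run I A σ) : ℝ)) / _))
  rw [hdist, mul_left_comm (α * (I.opt Finset.univ : ℝ)), mul_left_comm (n : ℝ),
    ← mul_div_assoc (α * (I.opt Finset.univ : ℝ)), ← mul_div_assoc (n : ℝ)]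
  refine mul_le_mul_of_nonneg_left ?_
    (mul_nonneg (mul_nonneg (pow_nonneg hp0.le _) (pow_nonneg h0 _)) (Nat.cast_nonneg _))
  exact div_le_div_of_nonneg_right
    (le_sum_weight_run hk hα hA (Nat.lt_succ_iff.1 T.2)) (Nat.cast_nonneg _)

end Ratio

/-- Every ratio up to `1 - p ^ k - q ^ k - p ^ k * log (1 - q ^ k)`, where `q = 1 - p`, is achieved
by sampling each arrival with probability `p`. -/
lemma achievesRatio_of_le {k : ℕ} (hk : 0 < k) {p : ℝ} (hp0 : 0 < p) (hp1 : p < 1) {c : ℝ}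
    (hc : c ≤ 1 - p ^ k - (1 - p) ^ k - p ^ k * Real.log (1 - (1 - p) ^ k)) :
    AchievesRatio k c := by
  set δ : ℝ := p ^ k * (1 - p) ^ k / (1 - (1 - p) ^ k) with hδ
  have hδ0 : 0 ≤ δ := by
    have h1 : (1 - p) ^ k ≤ 1 := pow_le_one₀ (by linarith) (by linarith)
    have h2 : 0 ≤ (1 - p) ^ k := pow_nonneg (by linarith) _
    exact div_nonneg (by positivity) (by linarith)
  refine ⟨fun n m => samplingAlgorithm n m k p hp0.le hp1.le, fun n => δ / n,
    tendsto_const_div_atTop_nhds_zero_nat δ, fun n m α hα hα1 I A hA => ?_⟩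
  rcases n.eq_zero_or_pos with rfl | hn
  · have hopt : (I.opt Finset.univ : ℝ) = 0 := by
      obtain ⟨M, -, hM⟩ := I.exists_isMatchingOn_weight_eq_opt Finset.univ
      rw [← hM, Instance.weight, Finset.eq_empty_of_isEmpty M]
      simp
    rw [hopt, mul_zero]
    exact Finset.sum_nonneg fun s _ => mul_nonneg ENNReal.toReal_nonneg
      (div_nonneg (Finset.sum_nonneg fun σ _ => NNReal.coe_nonneg _) (Nat.cast_nonneg _))
  · have hn' : (0 : ℝ) < n := by exact_mod_cast hn
    refine le_of_mul_le_mul_left ?_ hn'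
    refine le_trans ?_ (mul_opt_le_expectedWeight hk hn hp0 hp1 hα hA)
    set ρ := 1 - p ^ k - (1 - p) ^ k - p ^ k * Real.log (1 - (1 - p) ^ k)
    have h1 : α * c ≤ α * ρ := mul_le_mul_of_nonneg_left hc hα
    have h2 : α * δ ≤ δ := mul_le_of_le_one_left hδ0 hα1
    calc n * ((c * α - δ / n) * I.opt Finset.univ)
        = (n * (α * c) - δ) * I.opt Finset.univ := by field_simp
      _ ≤ (n * (α * ρ) - α * δ) * I.opt Finset.univ := by
          refine mul_le_mul_of_nonneg_right ?_ (NNReal.coe_nonneg _)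
          exact sub_le_sub (mul_le_mul_of_nonneg_left h1 hn'.le) h2
      _ = _ := by ring

end SecretaryMatching

theorem mainTheorem1 :
    SecretaryMatching.AchievesRatio 2 0.5721 ∧
    ∀ k : ℕ, 2 ≤ k →
      SecretaryMatching.AchievesRatio k
        (1 - 1 / 2 ^ (k - 1) + 1 / 2 ^ (2 * k) - 1 / (2 ^ (2 * k) * (2 ^ k - 1) ^ 2)) := by
  refine ⟨?_, fun k hk => ?_⟩
  · -- The ratio for two arrivals has its maximum near `p = 0.491`.
    refine SecretaryMatching.achievesRatio_of_le two_pos (p := 0.491) (by norm_num) (by norm_num) ?_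
    have hexp : Real.exp 0.2998 ≤ 1 / 0.740919 := by
      have h := Real.exp_bound' (x := 0.2998) (by norm_num) (by norm_num) (n := 6) (by norm_num)
      refine h.trans ?_
      norm_num [Finset.sum_range_succ, Nat.factorial]
    have hlog : Real.log 0.740919 ≤ -0.2998 := by
      rw [Real.log_le_iff_le_exp (by norm_num), Real.exp_neg, le_inv_comm₀ (by norm_num)
        (Real.exp_pos _)]
      simpa using hexp
    have hq : (1 : ℝ) - (1 - 0.491) ^ 2 = 0.740919 := by norm_num
    rw [hq]
    norm_num at hlog ⊢
    linarith
  · -- With `p = 1 / 2` and `b = 2 ^ (-k)`, the bound `- log (1 - b) ≥ b` suffices.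
    refine SecretaryMatching.achievesRatio_of_le (by omega) (p := 1 / 2) (by norm_num)
      (by norm_num) ?_
    have hq : (1 : ℝ) - 1 / 2 = 1 / 2 := by norm_num
    rw [hq]
    set b : ℝ := (1 / 2) ^ k with hb
    have hb0 : 0 < b := by positivity
    have hb1 : b < 1 := pow_lt_one₀ (by norm_num) (by norm_num) (by omega)
    have hlog := Real.log_le_sub_one_of_pos (x := 1 - b) (by linarith)
    have h1 : (1 : ℝ) / 2 ^ (k - 1) = 2 * b := by
      obtain ⟨j, rfl⟩ : ∃ j, k = j + 1 := ⟨k - 1, by omega⟩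
      rw [hb, Nat.add_sub_cancel, pow_succ, one_div_pow]; ring
    have h2 : (1 : ℝ) / 2 ^ (2 * k) = b * b := by
      rw [hb, ← pow_add, one_div_pow, two_mul]
    have h3 : (0 : ℝ) ≤ 1 / (2 ^ (2 * k) * (2 ^ k - 1) ^ 2) := by positivity
    have h4 : b * Real.log (1 - b) ≤ b * (1 - b - 1) := mul_le_mul_of_nonneg_left hlog hb0.le
    rw [h1, h2]
    linarith
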